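/- Setup. An ordered tree is a finite rooted tree in which the children of each vertex carry a total order. The canonical walk around an ordered tree starts in the root, visits the children of each vertex in increasing order, walks around the subtree of each child and then returns to the parent. Two ordered trees are isomorphic if a bijection of their vertex sets carries the canonical walk of one to the canonical walk of the other. Let the $I$-line and the $K$-line be two disjoint copies of $\{1,2,3,\dots\}$. We consider only ordered trees whose root lies on the $I$-line and in which every edge joins a point of the $I$-line with a point of the $K$-line. For such a tree with $l+1$ vertices, $l\ge 1$, the canonical walk has the form $i_1,k_1,i_2,k_2,\dots,i_l,k_l,i_1$; the tree is called $d$-banded if $|i_s-i_{s+1}|\le d$ for $s=1,\dots,l$, where $i_{l+1}:=i_1$. It is called canonical if, on each of the two lines, its vertices are numbered $1,2,3,\dots$ in the order in which the canonical walk visits them for the first time. Let $\mathcal B_{p,n,d,l+1}$ be the set of $d$-banded ordered trees of this kind with $l+1$ vertices, with vertices on the $I$-line in $\{1,\dots,p\}$ and vertices on the $K$-line in $\{1,\dots,n\}$. For natural numbers $N,k,m$ let $F(N,k,m)$ be the number of tuples $(a_1,\dots,a_k)\in\{1,\dots,m\}^k$ with $a_1+\dots+a_k=N$. Lemma. For every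 $l\ge 1$ there is a constant $C_l>0$, depending only on $l$, such that the following holds. Let $G^c$ be a canonical ordered tree with $l+1$ vertices, $r+1$ of them on the $I$-line, and hence with $l-r$ vertices on the $K$-line. Let $p,n\ge 0$ and $d\ge 1$ be integers, and let $[G^c]$ be the set of all trees in $\mathcal B_{p,n,d,l+1}$ that are isomorphic to $G^c$. Then $$\Bigl|\,|[G^c]|-p\,n^{l-r}\prod_{k^\ast}F\bigl(\deg(k^\ast)d,\deg(k^\ast),2d\bigr)\Bigr|\le C_l\left(n^{l-r}d^{r+1}+p\,n^{l-r}d^{r-1}+p\,d^{r}n^{l-r-1}\right),$$ where the product runs over the $l-r$ vertices $k^\ast$ of $G^c$ on the $K$-line and $\deg(k^\ast)$ is the degree of $k^\ast$ in $G^c$. -/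

import Mathlib

/-- A (nonempty, finite) ordered rooted tree with vertices labelled by elements of `α`:
a root `v` together with the list, from left to right, of the subtrees hanging off the
children of `v`.  The order of the list is the total order on the children of `v`.
(That distinct vertices carry distinct labels is the condition `labels.Nodup` below; a tree
satisfying it is the same thing as a tree on a set of elements of `α`, with a root and
a total order on the children of each vertex.) -/
inductive OrderedTree (α : Type) : Type where
  | node (v : α) (children : List (OrderedTree α)) : OrderedTree α

namespace OrderedTree

variable {α : Type}

/-- The root. -/
def root : OrderedTree α → α
  | node v _ => v

/-- All vertex labels, with multiplicity. -/
def labels : OrderedTree α → List α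
  | node v cs => v :: cs.flatMap (fun c => labels c)

/-- The edges, each one written as a pair (parent, child). -/
def edges : OrderedTree α → List (α × α)
  | node v cs => cs.flatMap (fun c => (v, root c) :: edges c)

/-- The canonical walk around the tree: start in the root; visit the children from left to
right, walking around the subtree of each child and then returning to the parent. -/
def walk : OrderedTree α → List α
  | node v cs => v :: cs.flatMap (fun c => walk c ++ [v])

/-- The vertex set. -/
def verts [DecidableEq α] (T : OrderedTree α) : Finset α := T.labels.toFinset

/-- The underlying simple graph. -/
def graph (T : OrderedTree α) : SimpleGraph α :=
  SimpleGraph.fromEdgeSet {e | ∃ x ∈ T.edges, e = s(x.1, x.2)}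

/-- The degree of a vertex: the number of edges incident with it. -/
noncomputable def deg (T : OrderedTree α) (v : α) : ℕ := (T.graph.incidenceSet v).ncard

/-- Two ordered trees are isomorphic if a bijection of their vertex sets carries the canonical
walk of the first one to the canonical walk of the second one. -/
def Iso [DecidableEq α] (T T' : OrderedTree α) : Prop :=
  ∃ π : α → α, Set.BijOn π (T.verts : Set α) (T'.verts : Set α) ∧ T'.walk = T.walk.map π

end OrderedTree

/-- The points of the two lines: `Sum.inl i` is the point `i` of the `I`-line and `Sum.inr k` is
the point `k` of the `K`-line. -/
abbrev LinePoint : Type := ℕ ⊕ ℕ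

/-- An ordered tree with distinct vertices on the two lines, such that the root lies on the
`I`-line and each edge joins a point of the `I`-line and a point of the `K`-line, that is, the
part of the bipartite graph that contains the root lies on the `I`-line and the other part on the
`K`-line. -/
structure IsLineTree (T : OrderedTree LinePoint) : Prop where
  nodup : T.labels.Nodup
  root_left : T.root.isLeft
  bipartite : ∀ e ∈ T.edges, e.1.isLeft ≠ e.2.isLeft

/-- The vertices on the `I`-line. -/
def iVerts (T : OrderedTree LinePoint) : Finset ℕ := (T.labels.filterMap Sum.getLeft?).toFinset

/-- The vertices on the `K`-line. -/
def kVerts (T : OrderedTree LinePoint) : Finset ℕ := (T.labels.filterMap Sum.getRight?).toFinset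

/-- For the canonical walk `i₁, k₁, …, i_l, k_l, i₁` this is the list `i₁, …, i_l, i₁`. -/
def iSeq (T : OrderedTree LinePoint) : List ℕ := T.walk.filterMap Sum.getLeft?

/-- For the canonical walk `i₁, k₁, …, i_l, k_l, i₁` this is the list `k₁, …, k_l`. -/
def kSeq (T : OrderedTree LinePoint) : List ℕ := T.walk.filterMap Sum.getRight?

/-- The ordered trees with `m` vertices, the part of the root in `{1, …, p}` on the
`I`-line, the other part in `{1, …, n}` on the `K`-line. -/
def lineTrees (p n m : ℕ) : Set (OrderedTree LinePoint) :=
  {T | IsLineTree T ∧ T.verts.card = m ∧ iVerts T ⊆ Finset.Icc 1 p ∧ kVerts T ⊆ Finset.Icc 1 n}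

/-- `|i_s - i_{s+1}| ≤ d` for `s = 1, …, l`, where `i_{l+1} = i₁`. -/
def IsBanded (d : ℕ) (T : OrderedTree LinePoint) : Prop :=
  (iSeq T).IsChain (fun a b => |(a : ℤ) - (b : ℤ)| ≤ (d : ℤ))

/-- The `d`-banded ordered trees with `m` vertices. -/
def bandedTrees (p n d m : ℕ) : Set (OrderedTree LinePoint) :=
  {T | T ∈ lineTrees p n m ∧ IsBanded d T}

/-- Relabelling of a sequence by order of first appearance: `x` is replaced by one plus the number
of distinct entries that precede the first occurrence of `x`. -/
def canonicalLabels (L : List ℕ) : List ℕ :=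
  L.map (fun x => (L.takeWhile (fun y => decide (y ≠ x))).toFinset.card + 1)

/-- A canonical ordered tree, that is, the canonical representative of its isomorphism class: on
each of the two lines the vertices are numbered `1, 2, …` in the order in which the canonical walk
visits them for the first time. -/
structure IsCanonical (T : OrderedTree LinePoint) : Prop where
  isLineTree : IsLineTree T
  iSeq_eq : canonicalLabels (iSeq T) = iSeq T
  kSeq_eq : canonicalLabels (kSeq T) = kSeq T

/-- The class of `T`: all `d`-banded ordered trees with `m` vertices that are isomorphic
to `T`. -/
def bandedClass (p n d m : ℕ) (T : OrderedTree LinePoint) : Set (OrderedTree LinePoint) :=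
  {T' | T' ∈ bandedTrees p n d m ∧ T.Iso T'}

/-- The number of `k`-compositions of `n` all of whose parts lie in `{1, …, m}`. -/
def restrictedCompositions (n k m : ℕ) : ℕ :=
  ((Fintype.piFinset (fun _ : Fin k => Finset.Icc 1 m)).filter (fun a => ∑ t, a t = n)).card

namespace OrderedTree

variable {α β : Type}

theorem induct {motive : OrderedTree α → Prop}
    (h : ∀ v cs, (∀ c ∈ cs, motive c) → motive (node v cs)) : ∀ t, motive t
  | node v cs => h v cs (fun c _ => induct h c)
termination_by t => sizeOf t

/-- The subtrees hanging off the children of the root. -/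
def subtrees : OrderedTree α → List (OrderedTree α)
  | node _ cs => cs

/-- Relabelling of the vertices. -/
def map (f : α → β) : OrderedTree α → OrderedTree β
  | node v cs => node (f v) (cs.map (fun c => map f c))

/-- A vertex together with its parent and its children, in order. -/
structure VertexStar (α : Type) : Type where
  center : α
  base : α
  leaves : List α

/-- The stars of the vertices other than the root, in the order of the canonical walk. -/
def stars : OrderedTree α → List (VertexStar α)
  | node v cs => cs.flatMap (fun c => ⟨root c, v, (subtrees c).map root⟩ :: stars c)

theorem root_mem_labels (t : OrderedTree α) : t.root ∈ t.labels := by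
  cases t; simp [root, labels]

theorem mem_labels_of_mem {v : α} {cs : List (OrderedTree α)} {c : OrderedTree α} (hc : c ∈ cs)
    {w : α} (hw : w ∈ c.labels) : w ∈ (node v cs).labels := by
  simp only [labels, List.mem_cons, List.mem_flatMap]
  exact Or.inr ⟨c, hc, hw⟩

theorem subtrees_root_mem_labels {t c : OrderedTree α} (h : c ∈ t.subtrees) :
    c.root ∈ t.labels := by
  cases t with
  | node v cs => exact mem_labels_of_mem h (root_mem_labels c)

theorem root_map (f : α → β) (t : OrderedTree α) : (t.map f).root = f t.root := by
  cases t; simp [root, map]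

theorem labels_map (f : α → β) (t : OrderedTree α) : (t.map f).labels = t.labels.map f := by
  induction t using induct with
  | h v cs ih =>
    simp only [map, labels, List.map_cons, List.flatMap_map, List.map_flatMap]
    congr 1
    exact List.flatMap_congr ih

theorem walk_map (f : α → β) (t : OrderedTree α) : (t.map f).walk = t.walk.map f := by
  induction t using induct with
  | h v cs ih =>
    simp only [map, walk, List.map_cons, List.flatMap_map, List.map_flatMap, List.map_append,
      List.map_nil]
    congr 1
    exact List.flatMap_congr fun c hc => by rw [ih c hc]

theorem edges_map (f : α → β) (t : OrderedTree α) :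
    (t.map f).edges = t.edges.map (Prod.map f f) := by
  induction t using induct with
  | h v cs ih =>
    simp only [map, edges, List.flatMap_map, List.map_flatMap, List.map_cons, Prod.map, root_map]
    exact List.flatMap_congr fun c hc => by rw [ih c hc]

theorem map_congr {f g : α → β} {t : OrderedTree α} (h : ∀ v ∈ t.labels, f v = g v) :
    t.map f = t.map g := by
  induction t using induct with
  | h v cs ih =>
    simp only [labels, List.mem_cons, List.mem_flatMap] at h
    simp only [map, node.injEq, List.map_inj_left]
    exact ⟨h v (Or.inl rfl), fun c hc => ih c hc fun w hw => h w (Or.inr ⟨c, hc, hw⟩)⟩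

theorem eq_of_map_eq {f g : α → β} {t : OrderedTree α} (h : t.map f = t.map g) :
    ∀ v ∈ t.labels, f v = g v := by
  have := congrArg labels h
  rw [labels_map, labels_map] at this
  exact List.map_inj_left.1 this

theorem mem_walk {t : OrderedTree α} {v : α} : v ∈ t.walk ↔ v ∈ t.labels := by
  induction t using induct with
  | h w cs ih =>
    simp only [walk, labels, List.mem_cons, List.mem_flatMap, List.mem_append, List.not_mem_nil,
      or_false]
    constructor
    · rintro (h | ⟨c, hc, h | h⟩)
      · exact Or.inl h
      · exact Or.inr ⟨c, hc, (ih c hc).1 h⟩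
      · exact Or.inl h
    · rintro (h | ⟨c, hc, h⟩)
      · exact Or.inl h
      · exact Or.inr ⟨c, hc, Or.inl ((ih c hc).2 h)⟩

theorem length_walk (t : OrderedTree α) : t.walk.length + 1 = 2 * t.labels.length := by
  induction t using induct with
  | h w cs ih =>
    simp only [walk, labels, List.length_cons, List.length_flatMap, List.length_append,
      List.length_nil]
    have : ∀ ds : List (OrderedTree α), (∀ c ∈ ds, c ∈ cs) →
        (ds.map fun c => c.walk.length + (0 + 1)).sum = 2 * (ds.map fun c => c.labels.length).sum := by
      intro ds hds
      induction ds with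
      | nil => simp
      | cons c ds ihd =>
        have h1 := ih c (hds c (by simp))
        have h2 := ihd fun c hc => hds c (by simp [hc])
        simp only [List.map_cons, List.sum_cons]
        omega
    have := this cs fun _ h => h
    omega

theorem nodup_of_mem {v : α} {cs : List (OrderedTree α)} (h : (node v cs).labels.Nodup)
    {c : OrderedTree α} (hc : c ∈ cs) : c.labels.Nodup := by
  simp only [labels, List.nodup_cons, List.nodup_flatMap] at h
  exact h.2.1 c hc

theorem not_mem_of_mem {v : α} {cs : List (OrderedTree α)} (h : (node v cs).labels.Nodup)
    {c : OrderedTree α} (hc : c ∈ cs) : v ∉ c.labels := by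
  simp only [labels, List.nodup_cons, List.mem_flatMap] at h
  exact fun h' => h.1 ⟨c, hc, h'⟩

theorem walk_eq_cons (t : OrderedTree α) : ∃ w, t.walk = t.root :: w := by
  cases t; exact ⟨_, by simp [walk, root]; rfl⟩

theorem append_cons_inj {v : α} : ∀ {l₁ l₁' l₂ l₂' : List α}, v ∉ l₁ → v ∉ l₁' →
    l₁ ++ v :: l₂ = l₁' ++ v :: l₂' → l₁ = l₁' ∧ l₂ = l₂'
  | [], [], _, _, _, _, h => by simpa using h
  | [], a :: l, _, _, _, h', h => by simp at h h'; exact absurd h.1 h'.1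
  | a :: l, [], _, _, h', _, h => by simp at h h'; exact absurd h.1.symm h'.1
  | a :: l, b :: l', _, _, h₁, h₂, h => by
    simp only [List.cons_append, List.cons.injEq, List.mem_cons, not_or] at h h₁ h₂
    have := append_cons_inj h₁.2 h₂.2 h.2
    exact ⟨by rw [h.1, this.1], this.2⟩

/-- An ordered tree with distinct labels is determined by its canonical walk. -/
theorem walk_injective {t t' : OrderedTree α} (h : t.labels.Nodup) (h' : t'.labels.Nodup)
    (hw : t.walk = t'.walk) : t = t' := by
  induction t using induct generalizing t' with
  | h v cs ih =>
    obtain ⟨v', cs'⟩ := t'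
    simp only [walk, List.cons.injEq] at hw
    obtain ⟨rfl, hw⟩ := hw
    congr 1
    have key : ∀ ds ds' : List (OrderedTree α), (∀ c ∈ ds, c ∈ cs) → (∀ c ∈ ds', c ∈ cs') →
        ds.flatMap (fun c => walk c ++ [v]) = ds'.flatMap (fun c => walk c ++ [v]) → ds = ds' := by
      intro ds
      induction ds with
      | nil =>
        intro ds' _ _ he
        cases ds' with
        | nil => rfl
        | cons c ds' => simp at he
      | cons c ds ihd =>
        intro ds' hds hds' he
        cases ds' with
        | nil => simp at he
        | cons c' ds' =>
          have hc := hds c (by simp)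
          have hc' := hds' c' (by simp)
          simp only [List.flatMap_cons, List.append_assoc, List.singleton_append] at he
          have h1 : v ∉ c.walk := fun hm => not_mem_of_mem h hc (mem_walk.1 hm)
          have h2 : v ∉ c'.walk := fun hm => not_mem_of_mem h' hc' (mem_walk.1 hm)
          replace he := append_cons_inj h1 h2 he
          rw [ih c hc (nodup_of_mem h hc) (nodup_of_mem h' hc') he.1,
            ihd ds' (fun c hc => hds c (by simp [hc])) (fun c hc => hds' c (by simp [hc])) he.2]
    exact key cs cs' (fun _ h => h) (fun _ h => h) hw

theorem labels_eq_root_cons_centers (t : OrderedTree α) :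
    t.labels = t.root :: t.stars.map VertexStar.center := by
  induction t using induct with
  | h v cs ih =>
    simp only [labels, root, stars, List.map_flatMap, List.map_cons]
    congr 1
    exact List.flatMap_congr ih

theorem mem_stars_node {v : α} {cs : List (OrderedTree α)} {s : VertexStar α} :
    s ∈ (node v cs).stars ↔
      ∃ c ∈ cs, s = ⟨c.root, v, c.subtrees.map root⟩ ∨ s ∈ c.stars := by
  simp [stars]

theorem center_mem_labels {t : OrderedTree α} {s : VertexStar α} (hs : s ∈ t.stars) :
    s.center ∈ t.labels := by
  rw [labels_eq_root_cons_centers]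
  exact List.mem_cons_of_mem _ (List.mem_map_of_mem hs)

theorem base_mem_labels {t : OrderedTree α} {s : VertexStar α} (hs : s ∈ t.stars) :
    s.base ∈ t.labels := by
  induction t using induct with
  | h v cs ih =>
    obtain ⟨c, hc, rfl | h⟩ := mem_stars_node.1 hs
    · simp [labels]
    · exact mem_labels_of_mem hc (ih c hc h)

theorem mem_leaves_subtree {t : OrderedTree α} {s : VertexStar α} (hs : s ∈ t.stars) {v : α}
    (hv : v ∈ s.leaves) : ∃ c ∈ t.subtrees, v ∈ c.labels ∧
      (v = c.root → ¬ c.labels.Nodup) := by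
  induction t using induct with
  | h w cs ih =>
    obtain ⟨c, hc, rfl | h⟩ := mem_stars_node.1 hs
    · refine ⟨c, hc, ?_⟩
      obtain ⟨u, ds⟩ := c
      simp only [subtrees, List.mem_map] at hv
      obtain ⟨e, he, rfl⟩ := hv
      refine ⟨subtrees_root_mem_labels he, fun h hn => not_mem_of_mem hn he ?_⟩
      simp only [root] at h
      rw [← h]
      exact root_mem_labels e
    · refine ⟨c, hc, ?_⟩
      obtain ⟨u, ds⟩ := c
      obtain ⟨e, he, h1, h2⟩ := ih _ hc h
      refine ⟨?_, fun h hn => not_mem_of_mem hn he ?_⟩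
      · exact mem_labels_of_mem he h1
      · simp only [root] at h
        rw [← h]
        exact h1

theorem leaf_mem_labels {t : OrderedTree α} {s : VertexStar α} (hs : s ∈ t.stars) {v : α}
    (hv : v ∈ s.leaves) : v ∈ t.labels := by
  obtain ⟨c, hc, h, -⟩ := mem_leaves_subtree hs hv
  obtain ⟨u, ds⟩ := t
  exact mem_labels_of_mem hc h

theorem disjoint_of_pairwise {v : α} {cs : List (OrderedTree α)} (h : (node v cs).labels.Nodup) :
    cs.Pairwise fun c c' => List.Disjoint c.labels c'.labels := by
  simp only [labels, List.nodup_cons, List.nodup_flatMap] at h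
  exact h.2.2

/-- The leaves of a later star avoid all leaves and the base of an earlier one. -/
def VertexStar.Before (s s' : VertexStar α) : Prop := s.base ∉ s'.leaves ∧ List.Disjoint s.leaves s'.leaves

theorem roots_nodup {t : OrderedTree α} (h : t.labels.Nodup) : (t.subtrees.map root).Nodup := by
  obtain ⟨v, cs⟩ := t
  have := disjoint_of_pairwise h
  simp only [subtrees]
  rw [List.Nodup, List.pairwise_map]
  exact this.imp fun hd he => hd (root_mem_labels _) (by rw [he]; exact root_mem_labels _)

theorem leaf_ne_root {t : OrderedTree α} (h : t.labels.Nodup) {s : VertexStar α} (hs : s ∈ t.stars)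
    {v : α} (hv : v ∈ s.leaves) : v ≠ t.root := by
  obtain ⟨c, hc, h1, -⟩ := mem_leaves_subtree hs hv
  obtain ⟨u, ds⟩ := t
  rintro rfl
  exact not_mem_of_mem h hc h1

theorem eq_of_mem_labels {v : α} {cs : List (OrderedTree α)} (h : (node v cs).labels.Nodup)
    {c c' : OrderedTree α} (hc : c ∈ cs) (hc' : c' ∈ cs) {w : α} (hw : w ∈ c.labels)
    (hw' : w ∈ c'.labels) : c = c' := by
  by_contra hne
  have : Std.Symm fun c c' : OrderedTree α => List.Disjoint c.labels c'.labels :=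
    ⟨fun _ _ h => h.symm⟩
  exact (disjoint_of_pairwise h).forall hc hc' hne hw hw'

theorem leaf_not_mem_roots {t : OrderedTree α} (h : t.labels.Nodup) {s : VertexStar α} (hs : s ∈ t.stars)
    {v : α} (hv : v ∈ s.leaves) : v ∉ t.subtrees.map root := by
  obtain ⟨c, hc, h1, h2⟩ := mem_leaves_subtree hs hv
  obtain ⟨u, ds⟩ := t
  intro hm
  obtain ⟨e, he, rfl⟩ := List.mem_map.1 hm
  obtain rfl := eq_of_mem_labels h hc he h1 (root_mem_labels e)
  exact h2 rfl (nodup_of_mem h hc)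

theorem stars_pairwise {t : OrderedTree α} (h : t.labels.Nodup) : t.stars.Pairwise VertexStar.Before := by
  induction t using induct with
  | h v cs ih =>
    rw [stars, List.pairwise_flatMap]
    constructor
    · intro c hc
      refine List.pairwise_cons.2 ⟨fun s hs => ⟨fun hv => ?_, fun w hw hw' => ?_⟩,
        ih c hc (nodup_of_mem h hc)⟩
      · exact not_mem_of_mem h hc (leaf_mem_labels hs hv)
      · exact leaf_not_mem_roots (nodup_of_mem h hc) hs hw' hw
    · refine (disjoint_of_pairwise h).imp_of_mem ?_
      intro c c' hc hc' hd s hs s' hs'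
      have h1 : s.base ∈ (node v cs).labels ∧ (s.base = v ∨ s.base ∈ c.labels) ∧
          ∀ w ∈ s.leaves, w ∈ c.labels := by
        rcases List.mem_cons.1 hs with rfl | hs
        · refine ⟨by simp [labels], Or.inl rfl, fun w hw => ?_⟩
          obtain ⟨e, he, rfl⟩ := List.mem_map.1 hw
          exact subtrees_root_mem_labels he
        · refine ⟨?_, Or.inr (base_mem_labels hs), fun w hw => leaf_mem_labels hs hw⟩
          exact mem_labels_of_mem hc (base_mem_labels hs)
      have h2 : ∀ w ∈ s'.leaves, w ∈ c'.labels := by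
        rcases List.mem_cons.1 hs' with rfl | hs'
        · intro w hw
          obtain ⟨e, he, rfl⟩ := List.mem_map.1 hw
          exact subtrees_root_mem_labels he
        · exact fun w hw => leaf_mem_labels hs' hw
      refine ⟨fun hb => ?_, fun w hw hw' => hd (h1.2.2 w hw) (h2 w hw')⟩
      rcases h1.2.1 with hv | hv
      · exact not_mem_of_mem h hc' (hv ▸ h2 _ hb)
      · exact hd hv (h2 _ hb)

theorem star_nodup {t : OrderedTree α} (h : t.labels.Nodup) {s : VertexStar α} (hs : s ∈ t.stars) :
    s.leaves.Nodup ∧ s.base ∉ s.leaves ∧ s.base ≠ s.center ∧ s.center ∉ s.leaves := by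
  induction t using induct with
  | h v cs ih =>
    obtain ⟨c, hc, rfl | hs⟩ := mem_stars_node.1 hs
    · refine ⟨roots_nodup (nodup_of_mem h hc), fun hv => ?_, fun hv => ?_, fun hv => ?_⟩
      · obtain ⟨e, he, rfl⟩ := List.mem_map.1 hv
        exact not_mem_of_mem h hc (subtrees_root_mem_labels he)
      · simp only at hv
        subst hv
        exact not_mem_of_mem h hc (root_mem_labels c)
      · obtain ⟨u, ds⟩ := c
        obtain ⟨e, he, hr⟩ := List.mem_map.1 hv
        simp only [root] at hr
        subst hr
        exact not_mem_of_mem (nodup_of_mem h hc) he (root_mem_labels e)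
    · exact ih c hc (nodup_of_mem h hc) hs

theorem mem_edges_node {v : α} {cs : List (OrderedTree α)} {e : α × α} :
    e ∈ (node v cs).edges ↔ ∃ c ∈ cs, e = (v, c.root) ∨ e ∈ c.edges := by
  simp [edges]

theorem mem_labels_of_mem_edges {t : OrderedTree α} {a b : α} (h : (a, b) ∈ t.edges) :
    a ∈ t.labels ∧ b ∈ t.labels ∧ (t.labels.Nodup → b ≠ t.root ∧ a ≠ b) := by
  induction t using induct with
  | h v cs ih =>
    obtain ⟨c, hc, he | he⟩ := mem_edges_node.1 h
    · obtain ⟨rfl, rfl⟩ := Prod.mk.inj he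
      have hr := root_mem_labels c
      refine ⟨by simp [labels], mem_labels_of_mem hc hr, fun hn => ?_⟩
      · have := not_mem_of_mem hn hc
        exact ⟨fun h => this (by simp only [root] at h; rwa [← h]), fun h => this (by rwa [h])⟩
    · obtain ⟨h1, h2, h3⟩ := ih c hc he
      refine ⟨mem_labels_of_mem hc h1, mem_labels_of_mem hc h2, fun hn => ⟨fun h => ?_, ?_⟩⟩
      · exact not_mem_of_mem hn hc (by simp only [root] at h; rwa [← h])
      · exact (h3 (nodup_of_mem hn hc)).2

theorem root_mem_edges {t : OrderedTree α} (h : t.labels.Nodup) {b : α} :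
    (t.root, b) ∈ t.edges ↔ b ∈ t.subtrees.map root := by
  obtain ⟨v, cs⟩ := t
  rw [mem_edges_node]
  simp only [root, subtrees, List.mem_map]
  constructor
  · rintro ⟨c, hc, he | he⟩
    · exact ⟨c, hc, (Prod.mk.inj he).2.symm⟩
    · exact absurd (mem_labels_of_mem_edges he).1 (not_mem_of_mem h hc)
  · rintro ⟨c, hc, rfl⟩
    exact ⟨c, hc, Or.inl rfl⟩

theorem edges_of_star {t : OrderedTree α} (h : t.labels.Nodup) {s : VertexStar α} (hs : s ∈ t.stars) :
    (∀ b, (s.center, b) ∈ t.edges ↔ b ∈ s.leaves) ∧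
      ∀ a, (a, s.center) ∈ t.edges ↔ a = s.base := by
  induction t using induct with
  | h v cs ih =>
    obtain ⟨c, hc, hcs⟩ := mem_stars_node.1 hs
    have hn := nodup_of_mem h hc
    have hcl : s.center ∈ c.labels := by
      rcases hcs with rfl | hcs
      · exact root_mem_labels c
      · exact center_mem_labels hcs
    have hvc : v ≠ s.center := fun he => not_mem_of_mem h hc (he ▸ hcl)
    have e1 : ∀ b, (s.center, b) ∈ (node v cs).edges ↔ (s.center, b) ∈ c.edges := by
      intro b
      rw [mem_edges_node]
      constructor
      · rintro ⟨c', hc', he | he⟩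
        · exact absurd (Prod.mk.inj he).1.symm hvc
        · rwa [eq_of_mem_labels h hc hc' hcl (mem_labels_of_mem_edges he).1]
      · exact fun he => ⟨c, hc, Or.inr he⟩
    have e2 : ∀ a, (a, s.center) ∈ (node v cs).edges ↔
        (a = v ∧ s.center = c.root) ∨ (a, s.center) ∈ c.edges := by
      intro a
      rw [mem_edges_node]
      constructor
      · rintro ⟨c', hc', he | he⟩
        · obtain ⟨ha, hr⟩ := Prod.mk.inj he
          obtain rfl := eq_of_mem_labels h hc hc' hcl (hr ▸ root_mem_labels c')
          exact Or.inl ⟨ha, hr⟩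
        · rw [eq_of_mem_labels h hc hc' hcl (mem_labels_of_mem_edges he).2.1]
          exact Or.inr he
      · rintro (⟨rfl, he⟩ | he)
        · exact ⟨c, hc, Or.inl (by rw [he])⟩
        · exact ⟨c, hc, Or.inr he⟩
    rcases hcs with rfl | hcs
    · refine ⟨fun b => ?_, fun a => ?_⟩
      · rw [e1]; exact root_mem_edges hn
      · rw [e2]
        refine ⟨?_, fun h => Or.inl ⟨h, rfl⟩⟩
        rintro (h | he)
        · exact h.1
        · exact absurd rfl ((mem_labels_of_mem_edges he).2.2 hn).1
    · obtain ⟨i1, i2⟩ := ih c hc hn hcs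
      refine ⟨fun b => by rw [e1, i1], fun a => ?_⟩
      rw [e2, i2]
      refine ⟨?_, Or.inr⟩
      rintro (⟨-, hr⟩ | he)
      · rw [labels_eq_root_cons_centers, List.nodup_cons] at hn
        exact absurd (hr ▸ List.mem_map_of_mem hcs) hn.1
      · exact he

theorem deg_center {t : OrderedTree α} (h : t.labels.Nodup) {s : VertexStar α} (hs : s ∈ t.stars) :
    t.deg s.center = s.leaves.length + 1 := by
  classical
  obtain ⟨e1, e2⟩ := edges_of_star h hs
  obtain ⟨n1, n2, n3, n4⟩ := star_nodup h hs
  have hset : t.graph.incidenceSet s.center =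
      (fun w => s(s.center, w)) '' ((s.base :: s.leaves).toFinset : Set α) := by
    ext e
    simp only [SimpleGraph.incidenceSet, graph, SimpleGraph.edgeSet_fromEdgeSet, Set.mem_ofPred_eq,
      Set.mem_image, Finset.mem_coe, List.mem_toFinset, List.mem_cons, Set.mem_sdiff]
    constructor
    · rintro ⟨⟨⟨⟨a, b⟩, hx, rfl⟩, -⟩, hm⟩
      rcases Sym2.mem_iff.1 hm with he | he
      · exact ⟨b, Or.inr ((e1 b).1 (he ▸ hx)), by rw [he]⟩
      · exact ⟨a, Or.inl ((e2 a).1 (he ▸ hx)), by rw [he, Sym2.eq_swap]⟩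
    · rintro ⟨w, rfl | hw, rfl⟩
      · refine ⟨⟨⟨(s.base, s.center), (e2 _).2 rfl, Sym2.eq_swap⟩, ?_⟩, by simp⟩
        simpa using n3.symm
      · refine ⟨⟨⟨(s.center, w), (e1 _).2 hw, rfl⟩, ?_⟩, by simp⟩
        rintro he
        simp only [Sym2.mem_diagSet, Sym2.mk_isDiag_iff] at he
        exact n4 (he ▸ hw)
  rw [deg, hset, Set.ncard_image_of_injective _ fun a b hab => Sym2.congr_right.1 hab,
    Set.ncard_coe_finset, List.toFinset_card_of_nodup (List.nodup_cons.2 ⟨n2, n1⟩),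
    List.length_cons]

end OrderedTree

namespace OrderedTree

variable {α β : Type}

theorem isChain_flatMap_append_singleton {ι : Type} (R : α → α → Prop) (v : α) (W : ι → List α)
    (cs : List ι) : List.IsChain R (v :: cs.flatMap (fun c => W c ++ [v])) ↔
      ∀ c ∈ cs, List.IsChain R (v :: (W c ++ [v])) := by
  induction cs with
  | nil => simp
  | cons c cs ih =>
    rw [List.flatMap_cons, List.append_assoc, List.singleton_append, ← List.cons_append,
      List.isChain_split, ih]
    simp

theorem isChain_flatMap_of_ends {ι : Type} (R : α → α → Prop) (W : ι → List α) (h : ι → α)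
    (cs : List ι) (hW : ∀ c ∈ cs, (∃ w, W c = h c :: w) ∧ ∃ w, W c = w ++ [h c]) (u v : α) :
    List.IsChain R (v :: (cs.flatMap W ++ [u])) ↔
      List.IsChain R (v :: (cs.map h ++ [u])) ∧ ∀ c ∈ cs, List.IsChain R (W c) := by
  induction cs generalizing v with
  | nil => simp
  | cons c cs ih =>
    obtain ⟨⟨w, hw⟩, w', hw'⟩ := hW c (by simp)
    have key : List.IsChain R (v :: (W c ++ (cs.flatMap W ++ [u]))) ↔
        R v (h c) ∧ List.IsChain R (W c) ∧ List.IsChain R (h c :: (cs.flatMap W ++ [u])) := by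
      have e1 : v :: (W c ++ (cs.flatMap W ++ [u])) =
          (v :: w') ++ h c :: (cs.flatMap W ++ [u]) := by simp [hw']
      have e2 : v :: w' ++ [h c] = v :: h c :: w := by rw [List.cons_append, ← hw', hw]
      rw [e1, List.isChain_split, e2, List.isChain_cons_cons, ← hw, and_assoc]
    rw [List.flatMap_cons, List.append_assoc, key, ih (fun c hc => hW c (by simp [hc]))]
    simp only [List.map_cons, List.cons_append, List.isChain_cons_cons, List.mem_cons,
      forall_eq_or_imp]
    tauto

theorem walk_eq_append (t : OrderedTree α) : ∃ w, t.walk = w ++ [t.root] := by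
  obtain ⟨v, cs⟩ := t
  rcases List.eq_nil_or_concat cs with rfl | ⟨l, c, rfl⟩
  · exact ⟨[], by simp [walk, root]⟩
  · refine ⟨v :: (l.flatMap (fun c => walk c ++ [v]) ++ walk c), ?_⟩
    simp [walk, root, List.flatMap_append]

/-- Each edge joins the two sides of the vertex set given by `side`. -/
def Bipartite (side : α → Bool) (t : OrderedTree α) : Prop :=
  ∀ e ∈ t.edges, side e.1 ≠ side e.2

theorem bipartite_node {side : α → Bool} {v : α} {cs : List (OrderedTree α)}
    (h : Bipartite side (node v cs)) {c : OrderedTree α} (hc : c ∈ cs) :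
    Bipartite side c ∧ side c.root = !side v := by
  refine ⟨fun e he => h e (mem_edges_node.2 ⟨c, hc, Or.inr he⟩), ?_⟩
  have := h (v, c.root) (mem_edges_node.2 ⟨c, hc, Or.inl rfl⟩)
  revert this
  cases side v <;> cases side c.root <;> simp

theorem star_side {side : α → Bool} {t : OrderedTree α} (h : Bipartite side t) {s : VertexStar α}
    (hs : s ∈ t.stars) : side s.base = !side s.center ∧ ∀ w ∈ s.leaves, side w = !side s.center := by
  induction t using induct with
  | h v cs ih =>
    obtain ⟨c, hc, rfl | hs⟩ := mem_stars_node.1 hs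
    · obtain ⟨h1, h2⟩ := bipartite_node h hc
      refine ⟨by simp [h2], fun w hw => ?_⟩
      obtain ⟨u, ds⟩ := c
      obtain ⟨e, he, rfl⟩ := List.mem_map.1 hw
      exact (bipartite_node h1 he).2
    · exact ih c hc (bipartite_node h hc).1 hs

theorem mem_labels_cases {t : OrderedTree α} {v : α} (hv : v ∈ t.labels) :
    v = t.root ∨ v ∈ t.subtrees.map root ∨ ∃ s ∈ t.stars, v ∈ s.leaves := by
  induction t using induct with
  | h w cs ih =>
    simp only [labels, List.mem_cons, List.mem_flatMap] at hv
    rcases hv with rfl | ⟨c, hc, hv⟩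
    · exact Or.inl rfl
    · right
      rcases ih c hc hv with rfl | hv | ⟨s, hs, hv⟩
      · exact Or.inl (List.mem_map_of_mem hc)
      · exact Or.inr ⟨_, mem_stars_node.2 ⟨c, hc, Or.inl rfl⟩, hv⟩
      · exact Or.inr ⟨s, mem_stars_node.2 ⟨c, hc, Or.inr hs⟩, hv⟩

/-- The vertices on the side of the root are the root and the leaves of the stars centred on the
other side. -/
theorem mem_labels_iff {side : α → Bool} {t : OrderedTree α} (h : Bipartite side t)
    (hr : side t.root = true) {v : α} :
    (v ∈ t.labels ∧ side v = true) ↔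
      v = t.root ∨ ∃ s ∈ t.stars, side s.center = false ∧ v ∈ s.leaves := by
  constructor
  · rintro ⟨hv, hl⟩
    rcases mem_labels_cases hv with rfl | hv | ⟨s, hs, hv⟩
    · exact Or.inl rfl
    · obtain ⟨u, ds⟩ := t
      obtain ⟨c, hc, rfl⟩ := List.mem_map.1 hv
      have := (bipartite_node h hc).2
      simp_all [root]
    · have := (star_side h hs).2 v hv
      exact Or.inr ⟨s, hs, by simp_all, hv⟩
  · rintro (rfl | ⟨s, hs, hc, hv⟩)
    · exact ⟨root_mem_labels t, hr⟩
    · exact ⟨leaf_mem_labels hs hv, by simp [(star_side h hs).2 v hv, hc]⟩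

theorem isChain_filter_walk_aux (R : α → α → Prop) {side : α → Bool} (t : OrderedTree α)
    (h : Bipartite side t) :
    (side t.root = true → (List.IsChain R (t.walk.filter side) ↔
      ∀ s ∈ t.stars, side s.center = false → List.IsChain R (s.base :: (s.leaves ++ [s.base])))) ∧
    (side t.root = false → ∀ v, List.IsChain R (v :: (t.walk.filter side ++ [v])) ↔
      List.IsChain R (v :: (t.subtrees.map root ++ [v])) ∧
      ∀ s ∈ t.stars, side s.center = false →
        List.IsChain R (s.base :: (s.leaves ++ [s.base]))) := by
  induction t using induct with
  | h v cs ih =>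
    have hst : ∀ p : VertexStar α → Prop, (∀ s ∈ (node v cs).stars, p s) ↔
        ∀ c ∈ cs, p ⟨c.root, v, c.subtrees.map root⟩ ∧ ∀ s ∈ c.stars, p s := by
      intro p
      simp only [mem_stars_node]
      constructor
      · exact fun h c hc => ⟨h _ ⟨c, hc, Or.inl rfl⟩, fun s hs => h s ⟨c, hc, Or.inr hs⟩⟩
      · rintro h s ⟨c, hc, rfl | hs⟩
        · exact (h c hc).1
        · exact (h c hc).2 s hs
    rw [hst]
    refine ⟨fun hr => ?_, fun hr u => ?_⟩
    · simp only [root] at hr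
      have e : (node v cs).walk.filter side =
          v :: cs.flatMap (fun c => c.walk.filter side ++ [v]) := by
        simp only [walk, List.filter_cons, hr, if_true, List.filter_flatMap, List.filter_append,
          List.filter_nil]
      rw [e, isChain_flatMap_append_singleton]
      refine forall₂_congr fun c hc => ?_
      obtain ⟨h1, h2⟩ := bipartite_node h hc
      have h2 : side c.root = false := by simp [h2, hr]
      rw [(ih c hc h1).2 h2]
      simp [h2]
    · simp only [root] at hr
      have e : (node v cs).walk.filter side = cs.flatMap (fun c => c.walk.filter side) := by
        simp only [walk, List.filter_cons, hr, List.filter_flatMap, List.filter_append,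
          List.filter_nil]
        simp
      have hside : ∀ c ∈ cs, side c.root = true := fun c hc => by
        simp [(bipartite_node h hc).2, hr]
      rw [e, isChain_flatMap_of_ends R _ root cs]
      · refine and_congr Iff.rfl (forall₂_congr fun c hc => ?_)
        rw [(ih c hc (bipartite_node h hc).1).1 (hside c hc)]
        simp [hside c hc]
      · intro c hc
        obtain ⟨w, hw⟩ := walk_eq_cons c
        obtain ⟨w', hw'⟩ := walk_eq_append c
        refine ⟨⟨w.filter side, ?_⟩, w'.filter side, ?_⟩
        · rw [hw, List.filter_cons_of_pos (hside c hc)]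
        · rw [hw', List.filter_append]
          simp [hside c hc]

/-- The steps of the canonical walk between the vertices on the side of the root go around the
vertices of the other side. -/
theorem isChain_filter_walk (R : α → α → Prop) {side : α → Bool} {t : OrderedTree α}
    (h : Bipartite side t) (hr : side t.root = true) :
    List.IsChain R (t.walk.filter side) ↔
      ∀ s ∈ t.stars, side s.center = false → List.IsChain R (s.base :: (s.leaves ++ [s.base])) :=
  (isChain_filter_walk_aux R t h).1 hr

theorem side_map {side : α → Bool} {side' : β → Bool} {f : α → β} {t : OrderedTree α}
    (h : Bipartite side t) (h' : Bipartite side' (t.map f))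
    (hr : side' (f t.root) = side t.root) : ∀ v ∈ t.labels, side' (f v) = side v := by
  induction t using induct with
  | h v cs ih =>
    intro w hw
    simp only [labels, List.mem_cons, List.mem_flatMap] at hw
    rcases hw with rfl | ⟨c, hc, hw⟩
    · exact hr
    · obtain ⟨h1, h2⟩ := bipartite_node h hc
      rw [map] at h'
      obtain ⟨h3, h4⟩ := bipartite_node h' (List.mem_map_of_mem hc)
      refine ih c hc h1 h3 ?_ w hw
      rw [root_map] at h4
      simp only [root] at hr
      rw [h4, h2, hr]

theorem bipartite_map {side : α → Bool} {side' : β → Bool} {f : α → β} {t : OrderedTree α}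
    (h : Bipartite side t) (hf : ∀ v ∈ t.labels, side' (f v) = side v) :
    Bipartite side' (t.map f) := by
  intro e he
  rw [edges_map, List.mem_map] at he
  obtain ⟨⟨a, b⟩, he, rfl⟩ := he
  obtain ⟨ha, hb, -⟩ := mem_labels_of_mem_edges he
  simp only [Prod.map]
  rw [hf a ha, hf b hb]
  exact h _ he

end OrderedTree

/-- The number of tuples `(a₁, …, aₘ)` of elements of `s` with `a₁ + … + aₘ = e`. -/
def tupleCount (s : Finset ℤ) : ℕ → ℤ → ℕ
  | 0, e => if e = 0 then 1 else 0
  | m + 1, e => ∑ t ∈ s, tupleCount s m (e - t)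

theorem card_filter_piFinset (s : Finset ℤ) (m : ℕ) (e : ℤ) :
    ((Fintype.piFinset (fun _ : Fin m => s)).filter (fun a => ∑ t, a t = e)).card =
      tupleCount s m e := by
  induction m generalizing e with
  | zero =>
    by_cases h : e = 0
    · subst h; simp [tupleCount]
    · simp [tupleCount, h, Ne.symm h]
  | succ m ih =>
    rw [tupleCount]
    simp_rw [← ih]
    rw [← Finset.card_sigma]
    refine Finset.card_bij' (fun a _ => ⟨a 0, fun i => a i.succ⟩)
      (fun b _ => Fin.cons b.1 b.2) ?_ ?_ ?_ ?_
    · intro a ha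
      simp only [Finset.mem_filter, Fintype.mem_piFinset, Fin.sum_univ_succ, Finset.mem_sigma]
        at ha ⊢
      exact ⟨ha.1 0, fun i => ha.1 i.succ, by linarith [ha.2]⟩
    · rintro ⟨b, c⟩ hb
      simp only [Finset.mem_filter, Fintype.mem_piFinset, Fin.sum_univ_succ, Finset.mem_sigma]
        at hb ⊢
      refine ⟨fun i => Fin.cases hb.1 hb.2.1 i, ?_⟩
      simp only [Fin.cons_zero, Fin.cons_succ]
      linarith [hb.2.2]
    · intro a _
      exact Fin.cons_self_tail a
    · rintro ⟨b, c⟩ _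
      simp

theorem tupleCount_le (s : Finset ℤ) (m : ℕ) (e : ℤ) : tupleCount s (m + 1) e ≤ s.card ^ m := by
  induction m generalizing e with
  | zero =>
    simp only [tupleCount, pow_zero, sub_eq_zero]
    rw [Finset.sum_ite_eq s e]
    split_ifs <;> simp
  | succ m ih =>
    rw [tupleCount]
    calc _ ≤ ∑ _t ∈ s, s.card ^ m := Finset.sum_le_sum fun t _ => ih _
      _ = s.card ^ (m + 1) := by rw [Finset.sum_const, smul_eq_mul]; ring

theorem tupleCount_mono {s s' : Finset ℤ} (h : s ⊆ s') (m : ℕ) (e : ℤ) :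
    tupleCount s m e ≤ tupleCount s' m e := by
  induction m generalizing e with
  | zero => simp [tupleCount]
  | succ m ih =>
    exact (Finset.sum_le_sum fun t _ => ih _).trans (Finset.sum_le_sum_of_subset h)

theorem tupleCount_insert_le {s : Finset ℤ} {a : ℤ} (ha : a ∉ s) (m : ℕ) (e : ℤ) :
    tupleCount (insert a s) (m + 2) e ≤
      tupleCount s (m + 2) e + (m + 2) * (insert a s).card ^ m := by
  have hs : s.card ≤ (insert a s).card := Finset.card_le_card (Finset.subset_insert _ _)
  induction m generalizing e with
  | zero =>
    have one : ∀ e', tupleCount (insert a s) 1 e' =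
        (if e' = a then 1 else 0) + tupleCount s 1 e' := by
      intro e'
      simp only [tupleCount, Finset.sum_insert ha, sub_eq_zero]
    rw [tupleCount, Finset.sum_insert ha]
    simp_rw [one]
    rw [Finset.sum_add_distrib]
    have h1 : (∑ t ∈ s, if e - t = a then 1 else 0) ≤ 1 := by
      have : ∀ t ∈ s, (if e - t = a then 1 else 0) = if e - a = t then 1 else 0 := fun t _ =>
        if_congr ⟨fun h => by omega, fun h => by omega⟩ rfl rfl
      rw [Finset.sum_congr rfl this, Finset.sum_ite_eq]
      split_ifs <;> simp
    have h2 := (one (e - a)).symm.trans_le (tupleCount_le (insert a s) 0 (e - a))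
    have h3 : ∑ t ∈ s, tupleCount s 1 (e - t) = tupleCount s 2 e := rfl
    simp only [pow_zero] at h2 ⊢
    rw [zero_add, h3]
    omega
  | succ m ih =>
    rw [tupleCount, Finset.sum_insert ha]
    have h1 : tupleCount (insert a s) (m + 2) (e - a) ≤ (insert a s).card ^ (m + 1) :=
      tupleCount_le (insert a s) (m + 1) (e - a)
    have h2 : ∑ t ∈ s, tupleCount (insert a s) (m + 2) (e - t) ≤
        tupleCount s (m + 3) e + s.card * ((m + 2) * (insert a s).card ^ m) := by
      calc _ ≤ ∑ t ∈ s, (tupleCount s (m + 2) (e - t) + (m + 2) * (insert a s).card ^ m) :=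
            Finset.sum_le_sum fun t _ => ih _
        _ = _ := by rw [Finset.sum_add_distrib, Finset.sum_const, smul_eq_mul]; rfl
    have h3 : s.card * ((m + 2) * (insert a s).card ^ m) ≤
        (insert a s).card * ((m + 2) * (insert a s).card ^ m) := Nat.mul_le_mul_right _ hs
    have h4 : (insert a s).card * ((m + 2) * (insert a s).card ^ m) =
        (m + 2) * (insert a s).card ^ (m + 1) := by ring
    have h5 : (m + 1 + 2) * (insert a s).card ^ (m + 1) =
        (m + 2) * (insert a s).card ^ (m + 1) + (insert a s).card ^ (m + 1) := by ring
    show tupleCount (insert a s) (m + 2) (e - a) +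
      ∑ t ∈ s, tupleCount (insert a s) (m + 2) (e - t) ≤ tupleCount s (m + 3) e + _
    linarith

theorem restrictedCompositions_eq (D d : ℕ) :
    restrictedCompositions (D * d) D (2 * d) = tupleCount (Finset.Icc (1 - (d : ℤ)) d) D 0 := by
  rw [← card_filter_piFinset, restrictedCompositions]
  refine Finset.card_bij' (fun a _ i => (a i : ℤ) - d) (fun b _ i => (b i + d).toNat) ?_ ?_ ?_ ?_
  · intro a ha
    simp only [Finset.mem_filter, Fintype.mem_piFinset, Finset.mem_Icc] at ha ⊢
    refine ⟨fun i => by have := ha.1 i; omega, ?_⟩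
    rw [Finset.sum_sub_distrib, ← Nat.cast_sum, ha.2]
    simp
  · intro b hb
    simp only [Finset.mem_filter, Fintype.mem_piFinset, Finset.mem_Icc] at hb ⊢
    refine ⟨fun i => by have := hb.1 i; omega, ?_⟩
    zify
    have : ∀ i ∈ Finset.univ, ((b i + d).toNat : ℤ) = b i + d := fun i _ =>
      Int.toNat_of_nonneg (by have := hb.1 i; omega)
    rw [Finset.sum_congr rfl this, Finset.sum_add_distrib, hb.2]
    simp
  · intro a _
    funext i
    simp
  · intro b hb
    simp only [Finset.mem_filter, Fintype.mem_piFinset, Finset.mem_Icc] at hb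
    funext i
    have := hb.1 i
    simp only
    omega

/-- The number of closed chains of `D` steps of length at most `d`. -/
noncomputable def bandedCycles (d D : ℕ) : ℕ := tupleCount (Finset.Icc (-(d : ℤ)) d) D 0

theorem insert_Icc (d : ℕ) : insert (-(d : ℤ)) (Finset.Icc (1 - (d : ℤ)) d) =
    Finset.Icc (-(d : ℤ)) d := by
  ext x; simp only [Finset.mem_insert, Finset.mem_Icc]; omega

theorem card_Icc_neg (d : ℕ) : (Finset.Icc (-(d : ℤ)) d).card = 2 * d + 1 := by
  rw [Int.card_Icc]; omega

theorem restrictedCompositions_le (D d : ℕ) :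
    restrictedCompositions (D * d) D (2 * d) ≤ bandedCycles d D := by
  rw [restrictedCompositions_eq]
  exact tupleCount_mono (by rw [← insert_Icc]; exact Finset.subset_insert _ _) _ _

theorem bandedCycles_le {d : ℕ} (hd : 1 ≤ d) (m : ℕ) : bandedCycles d (m + 1) ≤ (3 * d) ^ m := by
  refine (tupleCount_le _ _ _).trans (Nat.pow_le_pow_left ?_ _)
  rw [card_Icc_neg]; omega

theorem bandedCycles_sub_le {d : ℕ} (hd : 1 ≤ d) (m : ℕ) :
    d * bandedCycles d (m + 1) ≤
      d * restrictedCompositions ((m + 1) * d) (m + 1) (2 * d) + (m + 1) * (3 * d) ^ m := by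
  rw [restrictedCompositions_eq, bandedCycles]
  rcases m with _ | m
  · simp only [tupleCount, zero_sub, neg_eq_zero, zero_add, Finset.sum_ite_eq', Finset.mem_Icc]
    rw [if_pos (by omega), if_pos (by omega)]
    omega
  · have h := tupleCount_insert_le (s := Finset.Icc (1 - (d : ℤ)) d) (a := -(d : ℤ))
      (by simp) m 0
    rw [insert_Icc, card_Icc_neg] at h
    have h1 : (2 * d + 1) ^ m ≤ (3 * d) ^ m := Nat.pow_le_pow_left (by omega) _
    calc _ ≤ d * (tupleCount (Finset.Icc (1 - (d : ℤ)) d) (m + 2) 0 + (m + 2) * (3 * d) ^ m) :=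
          Nat.mul_le_mul_left _ (h.trans (by gcongr))
      _ ≤ _ := by
        have : d * ((m + 2) * (3 * d) ^ m) ≤ (m + 1 + 1) * (3 * d) ^ (m + 1) := by
          rw [pow_succ]
          nlinarith [Nat.zero_le ((m + 2) * (3 * d) ^ m * d)]
        rw [mul_add]
        exact Nat.add_le_add_left this _

theorem pow_le_descFactorial (n k : ℕ) :
    n ^ (k + 1) ≤ n.descFactorial (k + 1) + (k + 1) ^ 2 * n ^ k := by
  induction k with
  | zero => simp [Nat.descFactorial]
  | succ k ih =>
    have h1 : n * n.descFactorial (k + 1) ≤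
        n.descFactorial (k + 2) + (k + 1) * n.descFactorial (k + 1) := by
      rw [Nat.descFactorial_succ n (k + 1), ← Nat.add_mul]
      exact Nat.mul_le_mul_right _ (by omega)
    have h2 := Nat.descFactorial_le_pow n (k + 1)
    have h3 : (k + 1) * n.descFactorial (k + 1) ≤ (k + 1) * n ^ (k + 1) :=
      Nat.mul_le_mul_left _ h2
    calc n ^ (k + 1 + 1) = n * n ^ (k + 1) := by ring
      _ ≤ n * (n.descFactorial (k + 1) + (k + 1) ^ 2 * n ^ k) := Nat.mul_le_mul_left _ ih
      _ = n * n.descFactorial (k + 1) + (k + 1) ^ 2 * n ^ (k + 1) := by ring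
      _ ≤ n.descFactorial (k + 2) + ((k + 1) + (k + 1) ^ 2) * n ^ (k + 1) := by
        rw [add_mul]; omega
      _ ≤ _ := by gcongr; nlinarith

namespace OrderedTree

variable {α : Type}

/-- The values of `x` along the closed chain through the base and the leaves of a star have
steps of length at most `d`. -/
def VertexStar.Banded (d : ℕ) (x : α → ℤ) (s : VertexStar α) : Prop :=
  List.IsChain (fun u v => |x u - x v| ≤ (d : ℤ)) (s.base :: (s.leaves ++ [s.base]))

theorem exists_finset_path [DecidableEq α] (d : ℕ) (b' : ℤ) (cs : List α) (hcs : cs.Nodup)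
    (x : α → ℤ) (b : ℤ) : ∃ S : Finset (α → ℤ),
      (∀ y, y ∈ S ↔ (∀ v ∉ cs, y v = x v) ∧
        List.IsChain (fun u v : ℤ => |u - v| ≤ d) (b :: (cs.map y ++ [b']))) ∧
      S.card = tupleCount (Finset.Icc (-(d : ℤ)) d) (cs.length + 1) (b' - b) := by
  classical
  induction cs generalizing x b with
  | nil =>
    by_cases h : |b - b'| ≤ d
    · refine ⟨{x}, fun y => ?_, ?_⟩
      · simp [h, funext_iff]
      · have := abs_le.1 h
        simp only [tupleCount, List.length_nil, sub_eq_zero, Finset.sum_ite_eq, Finset.mem_Icc]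
        rw [if_pos (by omega), Finset.card_singleton]
    · refine ⟨∅, fun y => ?_, ?_⟩
      · simp [h]
      · simp only [tupleCount, List.length_nil, sub_eq_zero, Finset.sum_ite_eq, Finset.mem_Icc]
        rw [if_neg, Finset.card_empty]
        intro h'
        exact h (abs_le.2 (by omega))
  | cons c cs ih =>
    obtain ⟨hc, hcs⟩ := List.nodup_cons.1 hcs
    choose S hS hcard using fun t : ℤ => ih hcs (Function.update x c (b + t)) (b + t)
    have hval : ∀ t y, y ∈ S t → y c = b + t := fun t y hy => by
      rw [((hS t y).1 hy).1 c hc, Function.update_self]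
    refine ⟨(Finset.Icc (-(d : ℤ)) d).biUnion S, fun y => ?_, ?_⟩
    · simp only [Finset.mem_biUnion, List.map_cons, List.cons_append, List.isChain_cons_cons]
      constructor
      · rintro ⟨t, ht, hy⟩
        have hyc := hval t y hy
        obtain ⟨h1, h2⟩ := (hS t y).1 hy
        refine ⟨fun v hv => ?_, ?_, by rwa [hyc]⟩
        · simp only [List.mem_cons, not_or] at hv
          rw [h1 v hv.2, Function.update_of_ne hv.1]
        · rw [hyc, abs_le]
          have := Finset.mem_Icc.1 ht
          omega
      · rintro ⟨h1, h2, h3⟩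
        refine ⟨y c - b, ?_, (hS _ y).2 ⟨fun v hv => ?_, ?_⟩⟩
        · have := abs_le.1 h2
          exact Finset.mem_Icc.2 (by omega)
        · by_cases hvc : v = c
          · subst hvc; simp
          · rw [Function.update_of_ne hvc]
            exact h1 v (by simp [hvc, hv])
        · rwa [add_sub_cancel]
    · rw [Finset.card_biUnion, List.length_cons, tupleCount]
      · refine Finset.sum_congr rfl fun t _ => ?_
        rw [hcard, sub_sub]
      · intro t _ t' _ hne
        refine Finset.disjoint_left.2 fun y hy hy' => hne ?_
        have := hval t y hy
        have := hval t' y hy'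
        omega

theorem exists_finset_star [DecidableEq α] (d : ℕ) (s : VertexStar α) (hs : s.leaves.Nodup)
    (hb : s.base ∉ s.leaves) (x : α → ℤ) : ∃ S : Finset (α → ℤ),
      (∀ y, y ∈ S ↔ (∀ v ∉ s.leaves, y v = x v) ∧ s.Banded d y) ∧
      S.card = bandedCycles d (s.leaves.length + 1) := by
  obtain ⟨S, h1, h2⟩ := exists_finset_path d (x s.base) s.leaves hs x (x s.base)
  refine ⟨S, fun y => ?_, by rw [h2, sub_self, bandedCycles]⟩
  rw [h1]
  refine and_congr_right fun hy => ?_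
  have := hy _ hb
  rw [VertexStar.Banded, ← this]
  have e : y s.base :: (s.leaves.map y ++ [y s.base]) =
      (s.base :: (s.leaves ++ [s.base])).map y := by simp
  rw [e, List.isChain_map]

theorem exists_finset_stars [DecidableEq α] (d : ℕ) (L : List (VertexStar α))
    (hL : ∀ s ∈ L, s.leaves.Nodup ∧ s.base ∉ s.leaves) (hp : L.Pairwise VertexStar.Before)
    (x : α → ℤ) : ∃ S : Finset (α → ℤ),
      (∀ y, y ∈ S ↔ (∀ v, (∀ s ∈ L, v ∉ s.leaves) → y v = x v) ∧ ∀ s ∈ L, s.Banded d y) ∧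
      S.card = (L.map fun s => bandedCycles d (s.leaves.length + 1)).prod := by
  classical
  induction L generalizing x with
  | nil =>
    refine ⟨{x}, fun y => ?_, by simp⟩
    simp [funext_iff]
  | cons s L ih =>
    obtain ⟨hs, hL'⟩ := List.forall_mem_cons.1 hL
    obtain ⟨hb, hp'⟩ := List.pairwise_cons.1 hp
    obtain ⟨S, hS, hcard⟩ := exists_finset_star d s hs.1 hs.2 x
    choose S' hS' hcard' using fun x => ih hL' hp' x
    -- a later extension does not change the values on an earlier star
    have hfix : ∀ z y, y ∈ S' z → ∀ v ∈ s.base :: (s.leaves ++ [s.base]), y v = z v := by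
      intro z y hy v hv
      refine ((hS' z y).1 hy).1 v fun s' hs' hv' => ?_
      simp only [List.mem_cons, List.mem_append, List.not_mem_nil, or_false] at hv
      rcases hv with rfl | hv | rfl
      · exact (hb s' hs').1 hv'
      · exact (hb s' hs').2 hv hv'
      · exact (hb s' hs').1 hv'
    have hband : ∀ z y : α → ℤ, (∀ v ∈ s.base :: (s.leaves ++ [s.base]), y v = z v) →
        s.Banded d z → s.Banded d y := by
      intro z y h hz
      refine List.IsChain.imp_of_mem_imp (fun a b ha hb hab => ?_) hz
      rw [h a ha, h b hb]
      exact hab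
    refine ⟨S.biUnion S', fun y => ?_, ?_⟩
    · simp only [Finset.mem_biUnion, List.mem_cons, forall_eq_or_imp]
      constructor
      · rintro ⟨z, hz, hy⟩
        obtain ⟨z1, z2⟩ := (hS z).1 hz
        obtain ⟨y1, y2⟩ := (hS' z y).1 hy
        exact ⟨fun v hv => by rw [y1 v hv.2, z1 v hv.1], hband z y (hfix z y hy) z2, y2⟩
      · rintro ⟨h1, h2, h3⟩
        refine ⟨fun v => if ∃ s' ∈ L, v ∈ s'.leaves then x v else y v, ?_, ?_⟩
        · refine (hS _).2 ⟨fun v hv => ?_, ?_⟩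
          · split_ifs with h
            · rfl
            · push Not at h
              exact h1 v ⟨hv, h⟩
          · refine hband y _ (fun v hv => if_neg ?_) h2
            rintro ⟨s', hs', hv'⟩
            simp only [List.mem_cons, List.mem_append, List.not_mem_nil, or_false] at hv
            rcases hv with rfl | hv | rfl
            · exact (hb s' hs').1 hv'
            · exact (hb s' hs').2 hv hv'
            · exact (hb s' hs').1 hv'
        · refine (hS' _ y).2 ⟨fun v hv => ?_, h3⟩
          rw [if_neg]
          push Not
          exact hv
    · rw [Finset.card_biUnion]
      · simp only [hcard', Finset.sum_const, hcard, List.map_cons, List.prod_cons, smul_eq_mul]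
      · intro z hz z' hz' hne
        refine Finset.disjoint_left.2 fun y hy hy' => hne ?_
        funext v
        by_cases hv : v ∈ s.leaves
        · have hm : v ∈ s.base :: (s.leaves ++ [s.base]) := by simp [hv]
          rw [← hfix z y hy v hm, ← hfix z' y hy' v hm]
        · rw [((hS z).1 hz).1 v hv, ((hS z').1 hz').1 v hv]

end OrderedTree

open OrderedTree

theorem mem_iVerts {T : OrderedTree LinePoint} {i : ℕ} :
    i ∈ iVerts T ↔ Sum.inl i ∈ T.labels := by
  simp [iVerts]

theorem mem_kVerts {T : OrderedTree LinePoint} {k : ℕ} :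
    k ∈ kVerts T ↔ Sum.inr k ∈ T.labels := by
  simp [kVerts]

/-- The vertices on the `I`-line, as points. -/
def iPoints (T : OrderedTree LinePoint) : Finset LinePoint :=
  (T.labels.filter Sum.isLeft).toFinset

theorem mem_iPoints {T : OrderedTree LinePoint} {v : LinePoint} :
    v ∈ iPoints T ↔ v ∈ T.labels ∧ v.isLeft = true := by
  simp [iPoints]

/-- The stars around the vertices on the `K`-line. -/
def kStars (T : OrderedTree LinePoint) : List (VertexStar LinePoint) :=
  T.stars.filter fun s => s.center.isRight

theorem mem_kStars {T : OrderedTree LinePoint} {s : VertexStar LinePoint} :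
    s ∈ kStars T ↔ s ∈ T.stars ∧ s.center.isLeft = false := by
  simp [kStars]

theorem card_iPoints (T : OrderedTree LinePoint) : (iPoints T).card = (iVerts T).card := by
  rw [← Finset.card_image_of_injective (iVerts T) (Sum.inl_injective (β := ℕ))]
  congr 1
  ext v
  simp only [mem_iPoints, Finset.mem_image, mem_iVerts]
  constructor
  · rintro ⟨h, hv⟩
    obtain ⟨i, rfl⟩ := Sum.isLeft_iff.1 hv
    exact ⟨i, h, rfl⟩
  · rintro ⟨i, h, rfl⟩
    exact ⟨h, rfl⟩

theorem card_iVerts_add_card_kVerts (T : OrderedTree LinePoint) :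
    (iVerts T).card + (kVerts T).card = T.verts.card := by
  rw [← Finset.card_disjSum]
  congr 1
  ext v
  rcases v with v | v <;> simp [mem_iVerts, mem_kVerts, verts]

namespace IsLineTree

theorem card_verts {T : OrderedTree LinePoint} (hT : IsLineTree T) : T.verts.card = T.labels.length := List.toFinset_card_of_nodup hT.nodup

theorem bipartite_isLeft {T : OrderedTree LinePoint} (hT : IsLineTree T) : Bipartite Sum.isLeft T := hT.bipartite

theorem card_kVerts_pos {T : OrderedTree LinePoint} (hT : IsLineTree T) {l : ℕ} (hl : 1 ≤ l) (hc : T.verts.card = l + 1) :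
    0 < (kVerts T).card := by
  rw [hT.card_verts] at hc
  have h1 := hT.root_left
  have h2 := hT.bipartite_isLeft
  obtain ⟨v, cs⟩ := T
  rcases cs with _ | ⟨c, cs⟩
  · simp [labels] at hc; omega
  · have h3 := (bipartite_node h2 (List.mem_cons_self (a := c) (l := cs))).2
    simp only [root] at h1
    have h4 : c.root.isLeft = false := by rw [h3, h1]; rfl
    obtain ⟨k, hk⟩ := Sum.isRight_iff.1 (by simpa using h4)
    refine Finset.card_pos.2 ⟨k, mem_kVerts.2 ?_⟩
    rw [← hk]
    exact mem_labels_of_mem List.mem_cons_self (root_mem_labels c)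

theorem mem_iPoints_iff {T : OrderedTree LinePoint} (hT : IsLineTree T) {v : LinePoint} :
    v ∈ iPoints T ↔ v = T.root ∨ ∃ s ∈ kStars T, v ∈ s.leaves := by
  rw [mem_iPoints, mem_labels_iff hT.bipartite_isLeft hT.root_left]
  simp only [mem_kStars, and_assoc]

theorem root_mem_iPoints {T : OrderedTree LinePoint} (hT : IsLineTree T) : T.root ∈ iPoints T := hT.mem_iPoints_iff.2 (Or.inl rfl)

theorem star_subset {T : OrderedTree LinePoint} (hT : IsLineTree T) {s : VertexStar LinePoint} (hs : s ∈ kStars T) :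
    ∀ v ∈ s.base :: (s.leaves ++ [s.base]), v ∈ iPoints T := by
  obtain ⟨h1, h2⟩ := mem_kStars.1 hs
  obtain ⟨h3, h4⟩ := star_side hT.bipartite_isLeft h1
  intro v hv
  simp only [List.mem_cons, List.mem_append, List.not_mem_nil, or_false] at hv
  rw [mem_iPoints]
  rcases hv with rfl | hv | rfl
  · exact ⟨base_mem_labels h1, by rw [h3, h2]; rfl⟩
  · exact ⟨leaf_mem_labels h1 hv, by rw [h4 v hv, h2]; rfl⟩
  · exact ⟨base_mem_labels h1, by rw [h3, h2]; rfl⟩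

theorem kStars_pairwise {T : OrderedTree LinePoint} (hT : IsLineTree T) : (kStars T).Pairwise VertexStar.Before := (stars_pairwise hT.nodup).filter _

theorem kStars_nodup {T : OrderedTree LinePoint} (hT : IsLineTree T) {s : VertexStar LinePoint} (hs : s ∈ kStars T) :
    s.leaves.Nodup ∧ s.base ∉ s.leaves := by
  obtain ⟨h1, h2, -⟩ := star_nodup hT.nodup (mem_kStars.1 hs).1
  exact ⟨h1, h2⟩

theorem sum_leaves {T : OrderedTree LinePoint} (hT : IsLineTree T) : ((kStars T).map fun s => s.leaves.length).sum + 1 = (iVerts T).card := by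
  have hn : ((kStars T).flatMap VertexStar.leaves).Nodup :=
    List.nodup_flatMap.2 ⟨fun s hs => (hT.kStars_nodup hs).1, hT.kStars_pairwise.imp fun h => h.2⟩
  have hr : T.root ∉ (kStars T).flatMap VertexStar.leaves := by
    rw [List.mem_flatMap]
    rintro ⟨s, hs, hv⟩
    exact leaf_ne_root hT.nodup (mem_kStars.1 hs).1 hv rfl
  have he : iPoints T = (T.root :: (kStars T).flatMap VertexStar.leaves).toFinset := by
    ext v
    rw [hT.mem_iPoints_iff]
    simp [List.mem_flatMap]
  rw [← card_iPoints, he, List.toFinset_card_of_nodup (List.nodup_cons.2 ⟨hr, hn⟩),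
    List.length_cons, List.length_flatMap]

theorem prod_kVerts {T : OrderedTree LinePoint} (hT : IsLineTree T) {M : Type} [CommMonoid M] (g : ℕ → M) :
    ∏ k ∈ kVerts T, g (T.deg (Sum.inr k)) =
      ((kStars T).map fun s => g (s.leaves.length + 1)).prod := by
  have hl : T.labels.filterMap Sum.getRight? =
      (T.stars.map VertexStar.center).filterMap Sum.getRight? := by
    rw [labels_eq_root_cons_centers, List.filterMap_cons]
    obtain ⟨i, hi⟩ := Sum.isLeft_iff.1 hT.root_left
    rw [hi]
    rfl
  have hn : (T.labels.filterMap Sum.getRight?).Nodup := by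
    refine hT.nodup.filterMap ?_
    intro a a' b hb hb'
    rcases a with a | a <;> rcases a' with a' | a' <;> simp_all
  rw [kVerts, List.prod_toFinset _ hn, hl, kStars]
  have key : ∀ L : List (VertexStar LinePoint), (∀ s ∈ L, T.deg s.center = s.leaves.length + 1) →
      ((L.map VertexStar.center).filterMap Sum.getRight?).map (fun k => g (T.deg (Sum.inr k))) =
        (L.filter fun s => s.center.isRight).map fun s => g (s.leaves.length + 1) := by
    intro L hL
    induction L with
    | nil => rfl
    | cons s L ih =>
      obtain ⟨h1, h2⟩ := List.forall_mem_cons.1 hL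
      rw [List.map_cons, List.filterMap_cons, List.filter_cons]
      rcases hc : s.center with i | k
      · simpa using ih h2
      · rw [hc] at h1
        simpa [h1] using ih h2
  rw [key _ fun s hs => deg_center hT.nodup hs]

theorem length_kStars {T : OrderedTree LinePoint} (hT : IsLineTree T) : (kStars T).length = (kVerts T).card := by
  have := hT.prod_kVerts (M := Multiplicative ℕ) (fun _ => Multiplicative.ofAdd 1)
  simp only [Finset.prod_const, List.map_const', List.prod_replicate] at this
  have h := congrArg Multiplicative.toAdd this
  simpa using h.symm

end IsLineTree

/-- The position of a point on its line. -/
def position : LinePoint → ℤ := Sum.elim (fun i => (i : ℤ)) (fun k => (k : ℤ))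

theorem isChain_filterMap_getLeft (d : ℤ) (L : List LinePoint) :
    ((L.filterMap Sum.getLeft?).map (Nat.cast : ℕ → ℤ)).IsChain (fun a b => |a - b| ≤ d) ↔
      (L.filter Sum.isLeft).IsChain (fun u v => |position u - position v| ≤ d) := by
  have : L.filter Sum.isLeft = (L.filterMap Sum.getLeft?).map Sum.inl := by
    induction L with
    | nil => rfl
    | cons a L ih => rcases a with a | a <;> simp [List.filterMap_cons, List.filter_cons, ih]
  rw [this, List.isChain_map, List.isChain_map]
  rfl

theorem isBanded_map_iff {T : OrderedTree LinePoint} (hT : IsLineTree T) (d : ℕ)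
    {f : LinePoint → LinePoint} (hf : ∀ v ∈ T.labels, (f v).isLeft = v.isLeft) :
    IsBanded d (T.map f) ↔ ∀ s ∈ kStars T, s.Banded d fun v => position (f v) := by
  have hmap : IsBanded d (T.map f) ↔
      ((iSeq (T.map f)).map (Nat.cast : ℕ → ℤ)).IsChain (fun a b => |a - b| ≤ (d : ℤ)) := by
    rw [← List.flatMap_pure_eq_map]
    rfl
  rw [hmap, iSeq, walk_map, isChain_filterMap_getLeft, List.filter_map, List.isChain_map]
  have : T.walk.filter (Sum.isLeft ∘ f) = T.walk.filter Sum.isLeft :=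
    List.filter_congr fun v hv => hf v (mem_walk.1 hv)
  rw [this, isChain_filter_walk _ hT.bipartite_isLeft hT.root_left]
  simp only [mem_kStars, and_imp]
  rfl

theorem star_banded_congr {d : ℕ} {s : VertexStar LinePoint} {x y : LinePoint → ℤ}
    (h : ∀ v ∈ s.base :: (s.leaves ++ [s.base]), x v = y v) : s.Banded d x → s.Banded d y :=
  List.IsChain.imp_of_mem_imp fun a b ha hb hab => by rwa [← h a ha, ← h b hb]

/-- The admissible positions of the vertices on the `I`-line. -/
def IsAdmissible (p d : ℕ) (T : OrderedTree LinePoint) (y : LinePoint → ℤ) : Prop :=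
  (∀ v ∉ iPoints T, y v = 0) ∧ (∀ v ∈ iPoints T, 1 ≤ y v ∧ y v ≤ p) ∧
    Set.InjOn y (iPoints T) ∧ ∀ s ∈ kStars T, s.Banded d y

/-- Move the vertices on the `I`-line to the positions `y` and those on the `K`-line to `e`. -/
def relabel {n : ℕ} (T : OrderedTree LinePoint) (y : LinePoint → ℤ)
    (e : kVerts T ↪ Finset.Icc 1 n) : LinePoint → LinePoint
  | Sum.inl i => Sum.inl (y (Sum.inl i)).toNat
  | Sum.inr k => if h : k ∈ kVerts T then Sum.inr (e ⟨k, h⟩ : ℕ) else Sum.inr 0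

theorem isLeft_relabel {n : ℕ} {T : OrderedTree LinePoint} {y : LinePoint → ℤ}
    {e : kVerts T ↪ Finset.Icc 1 n} (v : LinePoint) : (relabel T y e v).isLeft = v.isLeft := by
  rcases v with i | k
  · rfl
  · rw [relabel]; split_ifs <;> rfl

theorem position_relabel {n p d : ℕ} {T : OrderedTree LinePoint} {y : LinePoint → ℤ}
    (hy : IsAdmissible p d T y) {e : kVerts T ↪ Finset.Icc 1 n} {v : LinePoint}
    (hv : v ∈ iPoints T) : position (relabel T y e v) = y v := by
  have h1 := hy.2.1 v hv
  rcases v with i | k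
  · simp only [relabel, position, Sum.elim_inl]
    omega
  · simp [mem_iPoints] at hv

theorem relabel_injOn {n p d : ℕ} {T : OrderedTree LinePoint} {y : LinePoint → ℤ}
    (hy : IsAdmissible p d T y) (e : kVerts T ↪ Finset.Icc 1 n) :
    Set.InjOn (relabel T y e) {v | v ∈ T.labels} := by
  intro v hv w hw h
  have hside : v.isLeft = w.isLeft := by
    rw [← isLeft_relabel (y := y) (e := e) v, h, isLeft_relabel]
  rcases v with i | k <;> rcases w with j | m
  · have hi : Sum.inl i ∈ iPoints T := mem_iPoints.2 ⟨hv, rfl⟩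
    have hj : Sum.inl j ∈ iPoints T := mem_iPoints.2 ⟨hw, rfl⟩
    refine hy.2.2.1 hi hj ?_
    rw [← position_relabel hy (e := e) hi, h, position_relabel hy hj]
  · simp at hside
  · simp at hside
  · have hk := mem_kVerts.2 hv
    have hm := mem_kVerts.2 hw
    simp only [relabel, dif_pos hk, dif_pos hm, Sum.inr.injEq] at h
    have := e.injective (Subtype.ext h)
    simp only [Subtype.mk.injEq] at this
    rw [this]

theorem map_relabel_mem {n p d l : ℕ} {T : OrderedTree LinePoint} (hT : IsLineTree T)
    (hc : T.verts.card = l + 1) {y : LinePoint → ℤ} (hy : IsAdmissible p d T y)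
    (e : kVerts T ↪ Finset.Icc 1 n) :
    T.map (relabel T y e) ∈ bandedClass p n d (l + 1) T := by
  have hinj := relabel_injOn hy e
  have hn : (T.map (relabel T y e)).labels.Nodup := by
    rw [labels_map]
    exact hT.nodup.map_on fun v hv w hw h => hinj hv hw h
  have hline : IsLineTree (T.map (relabel T y e)) :=
    ⟨hn, by rw [root_map, isLeft_relabel, hT.root_left],
      bipartite_map hT.bipartite_isLeft fun v _ => isLeft_relabel v⟩
  refine ⟨⟨⟨hline, ?_, ?_, ?_⟩, ?_⟩, relabel T y e, ?_, walk_map _ _⟩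
  · rw [hline.card_verts, labels_map, List.length_map, ← hT.card_verts, hc]
  · intro i hi
    rw [mem_iVerts, labels_map, List.mem_map] at hi
    obtain ⟨v, hv, hvi⟩ := hi
    have hvl : v.isLeft = true := by
      rw [← isLeft_relabel (y := y) (e := e) v, hvi]; rfl
    have hv' := mem_iPoints.2 ⟨hv, hvl⟩
    have h1 := position_relabel hy (e := e) hv'
    rw [hvi] at h1
    have h2 := hy.2.1 v hv'
    rw [← h1] at h2
    simp only [position, Sum.elim_inl] at h2
    rw [Finset.mem_Icc]
    omega
  · intro k hk
    rw [mem_kVerts, labels_map, List.mem_map] at hk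
    obtain ⟨v, hv, hvk⟩ := hk
    rcases v with i | m
    · simp [relabel] at hvk
    · have hm := mem_kVerts.2 hv
      simp only [relabel, dif_pos hm, Sum.inr.injEq] at hvk
      rw [← hvk]
      exact (e ⟨m, hm⟩).2
  · rw [isBanded_map_iff hT d fun v _ => isLeft_relabel v]
    exact fun s hs => star_banded_congr
      (fun v hv => (position_relabel hy (hT.star_subset hs v hv)).symm) (hy.2.2.2 s hs)
  · have h1 : ((T.map (relabel T y e)).verts : Set LinePoint) =
        relabel T y e '' (T.verts : Set LinePoint) := by
      ext v; simp [verts, labels_map]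
    rw [h1]
    refine Set.InjOn.bijOn_image (hinj.mono ?_)
    intro v hv
    simpa [verts] using hv

theorem exists_relabel {n p d m : ℕ} {T T' : OrderedTree LinePoint} (hT : IsLineTree T)
    (h : T' ∈ bandedClass p n d m T) :
    ∃ (y : LinePoint → ℤ) (e : kVerts T ↪ Finset.Icc 1 n), IsAdmissible p d T y ∧
      T.map (relabel T y e) = T' := by
  classical
  obtain ⟨⟨⟨hT', -, hi, hk⟩, hb⟩, π, hπ, hw⟩ := h
  have hinj : ∀ v ∈ T.labels, ∀ w ∈ T.labels, π v = π w → v = w := fun v hv w hw h =>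
    hπ.injOn (by simpa [verts] using hv) (by simpa [verts] using hw) h
  obtain rfl : T.map π = T' := by
    refine walk_injective ?_ hT'.nodup (by rw [walk_map, hw])
    rw [labels_map]
    exact hT.nodup.map_on hinj
  have hside : ∀ v ∈ T.labels, (π v).isLeft = v.isLeft :=
    side_map hT.bipartite_isLeft hT'.bipartite_isLeft (by
      rw [← root_map π, hT'.root_left, hT.root_left])
  have hL : ∀ v ∈ iPoints T, ∃ i ∈ Finset.Icc 1 p, π v = Sum.inl i := by
    intro v hv
    obtain ⟨h1, h2⟩ := mem_iPoints.1 hv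
    obtain ⟨i, hvi⟩ := Sum.isLeft_iff.1 ((hside v h1).trans h2)
    refine ⟨i, hi (mem_iVerts.2 ?_), hvi⟩
    rw [← hvi, labels_map]
    exact List.mem_map_of_mem h1
  have hR : ∀ k : kVerts T, ∃ m : Finset.Icc 1 n, π (Sum.inr k) = Sum.inr (m : ℕ) := by
    intro k
    have h1 := mem_kVerts.1 k.2
    have h2 : (π (Sum.inr k)).isLeft = false := hside _ h1
    obtain ⟨m, hm⟩ := Sum.isRight_iff.1 (by simpa using h2)
    refine ⟨⟨m, hk (mem_kVerts.2 ?_)⟩, hm⟩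
    rw [← hm, labels_map]
    exact List.mem_map_of_mem h1
  choose g hg using hR
  let y : LinePoint → ℤ := fun v => if v ∈ iPoints T then position (π v) else 0
  let e : kVerts T ↪ Finset.Icc 1 n := ⟨g, fun a b hab => by
    have := hinj _ (mem_kVerts.1 a.2) _ (mem_kVerts.1 b.2) (by rw [hg, hg, hab])
    exact Subtype.ext (Sum.inr_injective this)⟩
  have hy : ∀ v ∈ iPoints T, y v = position (π v) := fun v hv => if_pos hv
  refine ⟨y, e, ⟨fun v hv => if_neg hv, fun v hv => ?_, ?_, ?_⟩, map_congr fun v hv => ?_⟩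
  · obtain ⟨i, hi, hvi⟩ := hL v hv
    rw [hy v hv, hvi]
    have := Finset.mem_Icc.1 hi
    simp only [position, Sum.elim_inl]
    omega
  · intro v hv w hw hvw
    rw [hy v hv, hy w hw] at hvw
    obtain ⟨i, -, hvi⟩ := hL v hv
    obtain ⟨j, -, hwj⟩ := hL w hw
    refine hinj v (mem_iPoints.1 hv).1 w (mem_iPoints.1 hw).1 ?_
    rw [hvi, hwj] at hvw ⊢
    simp only [position, Sum.elim_inl, Nat.cast_inj] at hvw
    rw [hvw]
  · rw [isBanded_map_iff hT d hside] at hb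
    exact fun s hs => star_banded_congr (fun v hv => (hy v (hT.star_subset hs v hv)).symm) (hb s hs)
  · rcases v with i | k
    · have hm : Sum.inl i ∈ iPoints T := mem_iPoints.2 ⟨hv, rfl⟩
      obtain ⟨j, -, hj⟩ := hL _ hm
      simp only [relabel, hy _ hm, hj, position, Sum.elim_inl, Int.toNat_natCast]
    · have hm := mem_kVerts.2 hv
      simp only [relabel, dif_pos hm, e]
      exact (hg ⟨k, hm⟩).symm

theorem ncard_bandedClass {n p d l : ℕ} {T : OrderedTree LinePoint} (hT : IsLineTree T)
    (hc : T.verts.card = l + 1) {A : Finset (LinePoint → ℤ)}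
    (hA : ∀ y, y ∈ A ↔ IsAdmissible p d T y) :
    (bandedClass p n d (l + 1) T).ncard = A.card * n.descFactorial (kVerts T).card := by
  classical
  have himage : bandedClass p n d (l + 1) T =
      (fun q : (LinePoint → ℤ) × (kVerts T ↪ Finset.Icc 1 n) => T.map (relabel T q.1 q.2)) ''
        ((A ×ˢ Finset.univ : Finset ((LinePoint → ℤ) × (kVerts T ↪ Finset.Icc 1 n))) : Set _) := by
    ext T'
    simp only [Set.mem_image, Finset.mem_coe, Finset.mem_product, Finset.mem_univ, and_true,
      Prod.exists, hA]
    constructor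
    · intro h
      obtain ⟨y, e, hy, h⟩ := exists_relabel hT h
      exact ⟨y, e, hy, h⟩
    · rintro ⟨y, e, hy, rfl⟩
      exact map_relabel_mem hT hc hy e
  rw [himage, Set.InjOn.ncard_image, Set.ncard_coe_finset, Finset.card_product,
    Finset.card_univ, Fintype.card_embedding_eq]
  · simp
  · rintro ⟨y, e⟩ hq ⟨y', e'⟩ hq' h
    simp only [Finset.mem_coe, Finset.mem_product, Finset.mem_univ, and_true, hA] at hq hq'
    have h := eq_of_map_eq h
    refine Prod.ext (funext fun v => ?_) (DFunLike.ext _ _ fun k => ?_)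
    · simp only
      by_cases hv : v ∈ iPoints T
      · rw [← position_relabel hq (e := e) hv, h v (mem_iPoints.1 hv).1, position_relabel hq' hv]
      · simp only [hq.1 v hv, hq'.1 v hv]
    · have := h _ (mem_kVerts.1 k.2)
      simp only [relabel, dif_pos k.2, Sum.inr.injEq] at this
      exact Subtype.ext this

theorem abs_sub_le_of_isChain {α : Type} {x : α → ℤ} {d : ℕ} {L : List α}
    (h : L.IsChain fun u v => |x u - x v| ≤ (d : ℤ)) :
    ∀ u ∈ L, ∀ v ∈ L, |x u - x v| ≤ (L.length * d : ℕ) := by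
  have head : ∀ (L : List α) (a : α), (a :: L).IsChain (fun u v => |x u - x v| ≤ (d : ℤ)) →
      ∀ v ∈ L, |x a - x v| ≤ (L.length * d : ℕ) := by
    intro L
    induction L with
    | nil => simp
    | cons b L ih =>
      intro a h v hv
      rw [List.isChain_cons_cons] at h
      rcases List.mem_cons.1 hv with rfl | hv
      · refine h.1.trans ?_
        push_cast [List.length_cons]
        nlinarith [Nat.zero_le (L.length * d)]
      · have h1 := abs_sub_le (x a) (x b) (x v)
        have h2 := ih b h.2 v hv
        push_cast [List.length_cons] at h2 ⊢
        linarith [h.1]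
  induction L with
  | nil => simp
  | cons a L ih =>
    have hle : ((L.length * d : ℕ) : ℤ) ≤ (((a :: L).length * d : ℕ) : ℤ) := by
      exact_mod_cast Nat.mul_le_mul_right d (by simp)
    intro u hu v hv
    rcases List.mem_cons.1 hu with hua | hu' <;> rcases List.mem_cons.1 hv with hva | hv'
    · rw [hua, hva, sub_self, abs_zero]; positivity
    · rw [hua]; exact (head L a h v hv').trans hle
    · rw [hva, abs_sub_comm]; exact (head L a h u hu').trans hle
    · exact (ih h.of_cons u hu' v hv').trans hle

theorem IsLineTree.abs_sub_le {T : OrderedTree LinePoint} (hT : IsLineTree T) {l d : ℕ}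
    (hc : T.verts.card = l + 1) {y : LinePoint → ℤ} (hy : ∀ s ∈ kStars T, s.Banded d y) :
    ∀ u ∈ iPoints T, ∀ v ∈ iPoints T, |y u - y v| ≤ ((2 * l + 1) * d : ℕ) := by
  have hchain : (T.walk.filter Sum.isLeft).IsChain fun u v => |y u - y v| ≤ (d : ℤ) := by
    rw [isChain_filter_walk _ hT.bipartite_isLeft hT.root_left]
    exact fun s hs hl => hy s (mem_kStars.2 ⟨hs, hl⟩)
  have hlen : (T.walk.filter Sum.isLeft).length ≤ 2 * l + 1 := by
    have h1 := List.length_filter_le Sum.isLeft T.walk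
    have h2 := T.length_walk
    rw [hT.card_verts] at hc
    omega
  have hmem : ∀ u ∈ iPoints T, u ∈ T.walk.filter Sum.isLeft := fun u hu => by
    rw [List.mem_filter, mem_walk]
    exact mem_iPoints.1 hu
  intro u hu v hv
  refine (abs_sub_le_of_isChain hchain u (hmem u hu) v (hmem v hv)).trans ?_
  exact_mod_cast Nat.mul_le_mul_right d hlen

/-- The number of banded positions of the vertices on the `I`-line, for a fixed position of the
root. -/
noncomputable def rootedCount (d : ℕ) (T : OrderedTree LinePoint) : ℕ :=
  ((kStars T).map fun s => bandedCycles d (s.leaves.length + 1)).prod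

theorem exists_finset_rooted {T : OrderedTree LinePoint} (hT : IsLineTree T) (d : ℕ) (a : ℤ) :
    ∃ S : Finset (LinePoint → ℤ), (∀ y, y ∈ S ↔ (∀ v ∉ iPoints T, y v = 0) ∧ y T.root = a ∧
      ∀ s ∈ kStars T, s.Banded d y) ∧ S.card = rootedCount d T := by
  obtain ⟨S, hS, hcard⟩ := exists_finset_stars d (kStars T) (fun s hs => hT.kStars_nodup hs)
    hT.kStars_pairwise (Function.update 0 T.root a)
  refine ⟨S, fun y => ?_, hcard⟩
  rw [hS, ← and_assoc]
  refine and_congr_left fun _ => ?_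
  constructor
  · intro h
    refine ⟨fun v hv => ?_, ?_⟩
    · rw [hT.mem_iPoints_iff] at hv
      push Not at hv
      rw [h v hv.2, Function.update_of_ne hv.1]
      rfl
    · rw [h, Function.update_self]
      exact fun s hs hv => leaf_ne_root hT.nodup (mem_kStars.1 hs).1 hv rfl
  · rintro ⟨h1, h2⟩ v hv
    by_cases hr : v = T.root
    · rw [hr, h2, Function.update_self]
    · rw [Function.update_of_ne hr, h1]
      · rfl
      · rw [hT.mem_iPoints_iff]
        push Not
        exact ⟨hr, hv⟩

theorem card_coincidence_le {T : OrderedTree LinePoint} (hT : IsLineTree T) {p M r : ℕ}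
    (hr : (iVerts T).card = r + 1) {B : Finset (LinePoint → ℤ)}
    (h0 : ∀ y ∈ B, ∀ v ∉ iPoints T, y v = 0) (h1 : ∀ y ∈ B, y T.root ∈ Finset.Icc (1 : ℤ) p)
    (h2 : ∀ y ∈ B, ∀ v ∈ iPoints T, |y v - y T.root| ≤ M) {v w : LinePoint}
    (hw : w ∈ iPoints T) (hvw : v ≠ w) (hwr : w ≠ T.root) :
    (B.filter fun y => y v = y w).card ≤ p * (2 * M + 1) ^ (r - 1) := by
  classical
  have hcard : (((iPoints T).erase T.root).erase w).card = r - 1 := by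
    rw [Finset.card_erase_of_mem (Finset.mem_erase.2 ⟨hwr, hw⟩),
      Finset.card_erase_of_mem hT.root_mem_iPoints, card_iPoints, hr]
    omega
  set V := ((iPoints T).erase T.root).erase w
  have hle := Finset.card_le_card_of_injOn (s := B.filter fun y => y v = y w)
    (t := Finset.Icc (1 : ℤ) p ×ˢ Fintype.piFinset fun _ : V => Finset.Icc (-(M : ℤ)) M)
    (fun y => (y T.root, fun u => y u - y T.root)) ?_ ?_
  · refine hle.trans_eq ?_
    rw [Finset.card_product, Fintype.card_piFinset, Finset.prod_const, card_Icc_neg, Finset.card_univ,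
      Fintype.card_coe, hcard, Int.card_Icc]
    simp
  · intro y hy
    have hyB := (Finset.mem_filter.1 hy).1
    simp only [Finset.coe_product, Set.mem_prod, Finset.mem_coe, Fintype.mem_piFinset]
    refine ⟨h1 y hyB, fun u => ?_⟩
    have := h2 y hyB u (Finset.mem_of_mem_erase (Finset.mem_of_mem_erase u.2))
    rw [Finset.mem_Icc]
    exact abs_le.1 this
  · intro y hy y' hy' h
    obtain ⟨hyB, hyv⟩ := Finset.mem_filter.1 hy
    obtain ⟨hyB', hyv'⟩ := Finset.mem_filter.1 hy'
    obtain ⟨e1, e2⟩ := Prod.mk.inj h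
    have key : ∀ u, u ≠ w → y u = y' u := by
      intro u hu
      by_cases hur : u = T.root
      · rw [hur, e1]
      by_cases hui : u ∈ iPoints T
      · have := congrFun e2 ⟨u, Finset.mem_erase.2 ⟨hu, Finset.mem_erase.2 ⟨hur, hui⟩⟩⟩
        simp only at this
        omega
      · rw [h0 y hyB u hui, h0 y' hyB' u hui]
    funext u
    by_cases hu : u = w
    · rw [hu, ← hyv, ← hyv', key v hvw]
    · exact key u hu

theorem exists_finset_isAdmissible {T : OrderedTree LinePoint} (hT : IsLineTree T) {l r : ℕ}
    (hc : T.verts.card = l + 1) (hr : (iVerts T).card = r + 1) (p d : ℕ) :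
    ∃ A : Finset (LinePoint → ℤ), (∀ y, y ∈ A ↔ IsAdmissible p d T y) ∧
      A.card ≤ p * rootedCount d T ∧
      p * rootedCount d T ≤ A.card + 2 * ((2 * l + 1) * d) * rootedCount d T +
        (r + 1) * r * (p * (2 * ((2 * l + 1) * d) + 1) ^ (r - 1)) := by
  classical
  choose S hS hcard using exists_finset_rooted hT d
  set M := (2 * l + 1) * d with hM
  set P := rootedCount d T
  have hdist : ∀ a, ∀ y ∈ S a, ∀ v ∈ iPoints T, |y v - y T.root| ≤ M := fun a y hy v hv =>
    hT.abs_sub_le hc ((hS a y).1 hy).2.2 v hv _ hT.root_mem_iPoints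
  set B := (Finset.Icc (1 : ℤ) p).biUnion S with hB
  have hBmem : ∀ y, y ∈ B ↔ (∀ v ∉ iPoints T, y v = 0) ∧ y T.root ∈ Finset.Icc (1 : ℤ) p ∧
      ∀ s ∈ kStars T, s.Banded d y := by
    intro y
    simp only [hB, Finset.mem_biUnion, hS]
    constructor
    · rintro ⟨a, ha, h1, rfl, h2⟩
      exact ⟨h1, ha, h2⟩
    · rintro ⟨h1, ha, h2⟩
      exact ⟨_, ha, h1, rfl, h2⟩
  have hBcard : B.card = p * P := by
    rw [hB, Finset.card_biUnion]
    · simp [hcard, P]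
    · intro a _ a' _ hne
      refine Finset.disjoint_left.2 fun y hy hy' => hne ?_
      rw [← ((hS a y).1 hy).2.1, ((hS a' y).1 hy').2.1]
  set A := B.filter (IsAdmissible p d T)
  have hA : ∀ y, y ∈ A ↔ IsAdmissible p d T y := by
    intro y
    rw [Finset.mem_filter, hBmem]
    refine and_iff_right_of_imp fun h => ⟨h.1, ?_, h.2.2.2⟩
    exact Finset.mem_Icc.2 (h.2.1 _ hT.root_mem_iPoints)
  refine ⟨A, hA, ?_, ?_⟩
  · rw [← hBcard]
    exact Finset.card_filter_le _ _
  set E := (Finset.Icc (1 : ℤ) M ∪ Finset.Icc (p - M + 1 : ℤ) p).biUnion S with hE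
  set F := (iPoints T).offDiag.biUnion fun q => B.filter fun y => y q.1 = y q.2 with hF
  have hEcard : E.card ≤ 2 * M * P := by
    rw [hE]
    refine Finset.card_biUnion_le_card_mul _ _ P (fun a _ => (hcard a).le) |>.trans ?_
    refine Nat.mul_le_mul_right _ ((Finset.card_union_le _ _).trans ?_)
    rw [Int.card_Icc, Int.card_Icc]
    omega
  have hFcard : F.card ≤ (r + 1) * r * (p * (2 * M + 1) ^ (r - 1)) := by
    have hoff : (iPoints T).offDiag.card = (r + 1) * r := by
      rw [Finset.offDiag_card, card_iPoints, hr, Nat.mul_succ, Nat.add_sub_cancel]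
    rw [← hoff]
    refine Finset.card_biUnion_le_card_mul _ _ _ ?_
    rintro ⟨v, w⟩ hq
    obtain ⟨hv, hw, hne⟩ := Finset.mem_offDiag.1 hq
    have b0 : ∀ y ∈ B, ∀ v ∉ iPoints T, y v = 0 := fun y hy => ((hBmem y).1 hy).1
    have b1 : ∀ y ∈ B, y T.root ∈ Finset.Icc (1 : ℤ) p := fun y hy => ((hBmem y).1 hy).2.1
    have b2 : ∀ y ∈ B, ∀ v ∈ iPoints T, |y v - y T.root| ≤ M := by
      intro y hy
      obtain ⟨a, -, hya⟩ := Finset.mem_biUnion.1 hy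
      exact hdist a y hya
    by_cases hwr : w = T.root
    · have hvr : v ≠ T.root := fun h => hne (h.trans hwr.symm)
      have := card_coincidence_le hT hr b0 b1 b2 hv hne.symm hvr
      simpa only [eq_comm] using this
    · exact card_coincidence_le hT hr b0 b1 b2 hw hne hwr
  have hsub : B ⊆ A ∪ E ∪ F := by
    intro y hy
    by_contra hnot
    simp only [Finset.mem_union, not_or] at hnot
    obtain ⟨⟨hyA, hyE⟩, hyF⟩ := hnot
    obtain ⟨h0, h1, h2⟩ := (hBmem y).1 hy
    refine hyA ((hA y).2 ⟨h0, fun v hv => ?_, fun v hv w hw hvw => ?_, h2⟩)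
    · have hya : y ∈ S (y T.root) := (hS _ y).2 ⟨h0, rfl, h2⟩
      have hroot : y T.root ∉ Finset.Icc (1 : ℤ) M ∪ Finset.Icc (p - M + 1 : ℤ) p :=
        fun h => hyE (Finset.mem_biUnion.2 ⟨_, h, hya⟩)
      simp only [Finset.mem_union, Finset.mem_Icc] at hroot h1
      have := abs_le.1 (hdist _ y hya v hv)
      omega
    · by_contra hne
      exact hyF (Finset.mem_biUnion.2
        ⟨(v, w), Finset.mem_offDiag.2 ⟨hv, hw, hne⟩, Finset.mem_filter.2 ⟨hy, hvw⟩⟩)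
  rw [← hBcard]
  calc B.card ≤ (A ∪ E ∪ F).card := Finset.card_le_card hsub
    _ ≤ A.card + E.card + F.card :=
      (Finset.card_union_le _ _).trans (Nat.add_le_add_right (Finset.card_union_le _ _) _)
    _ ≤ _ := by omega

theorem prod_bandedCycles_le {d : ℕ} (hd : 1 ≤ d) (L : List ℕ) :
    (L.map fun m => bandedCycles d (m + 1)).prod ≤ (3 * d) ^ L.sum := by
  induction L with
  | nil => simp
  | cons m L ih =>
    rw [List.map_cons, List.prod_cons, List.sum_cons, pow_add]
    exact Nat.mul_le_mul (bandedCycles_le hd m) ih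

theorem prod_restrictedCompositions_le (d : ℕ) (L : List ℕ) :
    (L.map fun m => restrictedCompositions ((m + 1) * d) (m + 1) (2 * d)).prod ≤
      (L.map fun m => bandedCycles d (m + 1)).prod := by
  induction L with
  | nil => simp
  | cons m L ih =>
    simp only [List.map_cons, List.prod_cons]
    exact Nat.mul_le_mul (restrictedCompositions_le (m + 1) d) ih

theorem prod_bandedCycles_sub_le {d : ℕ} (hd : 1 ≤ d) (L : List ℕ) :
    d * (L.map fun m => bandedCycles d (m + 1)).prod ≤
      d * (L.map fun m => restrictedCompositions ((m + 1) * d) (m + 1) (2 * d)).prod +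
        (L.sum + L.length) * (3 * d) ^ L.sum := by
  induction L with
  | nil => simp
  | cons m L ih =>
    have h1 := bandedCycles_sub_le hd m
    have h2 := bandedCycles_le hd m
    have h3 := (prod_restrictedCompositions_le d L).trans (prod_bandedCycles_le hd L)
    simp only [List.map_cons, List.prod_cons, List.sum_cons, List.length_cons, pow_add]
    set f := bandedCycles d (m + 1)
    set g := restrictedCompositions ((m + 1) * d) (m + 1) (2 * d)
    set f' := (L.map fun m => bandedCycles d (m + 1)).prod
    set g' := (L.map fun m => restrictedCompositions ((m + 1) * d) (m + 1) (2 * d)).prod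
    set q := (3 * d) ^ m
    set Q := (3 * d) ^ L.sum
    calc d * (f * f') = f * (d * f') := by ring
      _ ≤ f * (d * g' + (L.sum + L.length) * Q) := Nat.mul_le_mul_left _ ih
      _ = (d * f) * g' + f * ((L.sum + L.length) * Q) := by ring
      _ ≤ (d * g + (m + 1) * q) * g' + q * ((L.sum + L.length) * Q) := by gcongr
      _ = d * (g * g') + (m + 1) * q * g' + q * ((L.sum + L.length) * Q) := by ring
      _ ≤ d * (g * g') + (m + 1) * q * Q + q * ((L.sum + L.length) * Q) := by gcongr
      _ = _ := by ring

theorem mul_pow_pred_le {l d : ℕ} (hd : 1 ≤ d) (r : ℕ) :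
    d * (r * (2 * ((2 * l + 1) * d) + 1) ^ (r - 1)) ≤ r * ((6 * l + 3) ^ r * d ^ r) := by
  rcases r with _ | r
  · simp
  · have h1 : 2 * ((2 * l + 1) * d) + 1 ≤ (6 * l + 3) * d := by nlinarith
    have h2 : d ≤ (6 * l + 3) * d := Nat.le_mul_of_pos_left d (by omega)
    calc _ = (r + 1) * (d * (2 * ((2 * l + 1) * d) + 1) ^ r) := by rw [Nat.add_sub_cancel]; ring
      _ ≤ (r + 1) * (((6 * l + 3) * d) * ((6 * l + 3) * d) ^ r) := by gcongr
      _ = _ := by rw [← pow_succ', mul_pow]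

theorem lemma2p2 (l : ℕ) (hl : 1 ≤ l) :
    ∃ C : ℝ, 0 < C ∧
      ∀ (r : ℕ) (T : OrderedTree LinePoint), IsCanonical T → T.verts.card = l + 1 →
        (iVerts T).card = r + 1 →
        ∀ p n d : ℕ, 1 ≤ d →
          |((bandedClass p n d (l + 1) T).ncard : ℝ)
              - (p : ℝ) * (n : ℝ) ^ (l - r)
                * ∏ k ∈ kVerts T,
                  (restrictedCompositions (T.deg (Sum.inr k) * d) (T.deg (Sum.inr k)) (2 * d) : ℝ)|
            ≤ C * ((n : ℝ) ^ (l - r) * (d : ℝ) ^ (r + 1)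
                + (p : ℝ) * (n : ℝ) ^ (l - r) * (d : ℝ) ^ ((r : ℤ) - 1)
                + (p : ℝ) * (d : ℝ) ^ r * (n : ℝ) ^ (l - r - 1)) := by
  set c₁ : ℕ := 2 * (2 * l + 1) * 3 ^ l with hc₁
  set c₂ : ℕ := l * 3 ^ l with hc₂
  set c₃ : ℕ := (l + 1) * l * (6 * l + 3) ^ l with hc₃
  set c₄ : ℕ := l ^ 2 * 3 ^ l with hc₄
  refine ⟨(c₁ + c₂ + c₃ + c₄ : ℕ), by positivity, ?_⟩
  intro r T hcan hcard hi p n d hd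
  have hT := hcan.isLineTree
  obtain ⟨k, hk⟩ := Nat.exists_eq_succ_of_ne_zero (hT.card_kVerts_pos hl hcard).ne'
  have hsum := card_iVerts_add_card_kVerts T
  rw [hi, hcard, hk] at hsum
  have hlr : l - r = k + 1 := by omega
  have hrl : r ≤ l := by omega
  have hkl : k + 1 ≤ l := by omega
  obtain ⟨A, hA, hAle, hAge⟩ := exists_finset_isAdmissible hT hcard hi p d
  have hncard := ncard_bandedClass (n := n) hT hcard hA
  rw [hk] at hncard
  have hleaves := hT.sum_leaves
  rw [hi, Nat.add_right_cancel_iff] at hleaves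
  have hlen := hT.length_kStars
  set L := (kStars T).map fun s => s.leaves.length with hL
  have hLlen : L.length = k + 1 := by rw [hL, List.length_map, hlen, hk]
  have hP : rootedCount d T = (L.map fun m => bandedCycles d (m + 1)).prod := by
    rw [hL, List.map_map]; rfl
  have hF : ∏ k ∈ kVerts T,
      restrictedCompositions (T.deg (Sum.inr k) * d) (T.deg (Sum.inr k)) (2 * d) =
        (L.map fun m => restrictedCompositions ((m + 1) * d) (m + 1) (2 * d)).prod := by
    rw [hT.prod_kVerts fun D => restrictedCompositions (D * d) D (2 * d), hL, List.map_map]; rfl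
  have hFP := prod_restrictedCompositions_le d L
  have hPF := prod_bandedCycles_sub_le hd L
  have hPle := prod_bandedCycles_le hd L
  have hDle := Nat.descFactorial_le_pow n (k + 1)
  have hDge := pow_le_descFactorial n k
  rw [← hP] at hPF hPle hFP
  rw [← hF] at hPF hFP
  rw [hLlen, hleaves, show r + (k + 1) = l by omega] at hPF
  rw [hleaves] at hPle
  have hthree : (3 * d) ^ r ≤ 3 ^ l * d ^ r := by
    rw [mul_pow]
    exact Nat.mul_le_mul_right _ (Nat.pow_le_pow_right (by norm_num) hrl)
  replace hPF := hPF.trans (Nat.add_le_add_left (Nat.mul_le_mul_left l hthree) _)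
  replace hPle := hPle.trans hthree
  have hE : d * ((r + 1) * r * (p * (2 * ((2 * l + 1) * d) + 1) ^ (r - 1))) ≤
      c₃ * (p * d ^ r) := by
    calc _ = (r + 1) * p * (d * (r * (2 * ((2 * l + 1) * d) + 1) ^ (r - 1))) := by ring
      _ ≤ (r + 1) * p * (r * ((6 * l + 3) ^ r * d ^ r)) :=
        Nat.mul_le_mul_left _ (mul_pow_pred_le hd r)
      _ ≤ (l + 1) * p * (l * ((6 * l + 3) ^ l * d ^ r)) := by
        gcongr
        omega
      _ = _ := by rw [hc₃]; ring
  set N := (bandedClass p n d (l + 1) T).ncard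
  set P := rootedCount d T
  set D := n.descFactorial (k + 1)
  set G := ∏ k ∈ kVerts T,
    restrictedCompositions (T.deg (Sum.inr k) * d) (T.deg (Sum.inr k)) (2 * d)
  set E := (r + 1) * r * (p * (2 * ((2 * l + 1) * d) + 1) ^ (r - 1))
  have upper : d * N ≤ d * (p * n ^ (k + 1) * G) + c₂ * (p * n ^ (k + 1) * d ^ r) := by
    calc d * N = d * (A.card * D) := by rw [hncard]
      _ ≤ d * ((p * P) * n ^ (k + 1)) := by gcongr
      _ = p * n ^ (k + 1) * (d * P) := by ring
      _ ≤ p * n ^ (k + 1) * (d * G + l * (3 ^ l * d ^ r)) := by gcongr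
      _ = _ := by rw [hc₂]; ring
  have lower : d * (p * n ^ (k + 1) * G) ≤ d * N + (d * (c₁ * (n ^ (k + 1) * d ^ (r + 1))) +
      c₃ * (p * n ^ (k + 1) * d ^ r) + d * (c₄ * (p * d ^ r * n ^ k))) := by
    calc d * (p * n ^ (k + 1) * G) ≤ d * (p * n ^ (k + 1) * P) := by gcongr
      _ = d * (p * P * n ^ (k + 1)) := by ring
      _ ≤ d * (p * P * (D + (k + 1) ^ 2 * n ^ k)) := by gcongr
      _ = d * (p * P * D) + d * (p * P * (k + 1) ^ 2 * n ^ k) := by ring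
      _ ≤ d * ((A.card + 2 * ((2 * l + 1) * d) * P + E) * D) +
          d * (p * (3 ^ l * d ^ r) * l ^ 2 * n ^ k) := by gcongr
      _ = d * N + (d * (2 * ((2 * l + 1) * d) * P * D) + (d * E) * D +
          d * (c₄ * (p * d ^ r * n ^ k))) := by rw [hncard, hc₄]; ring
      _ ≤ d * N + (d * (2 * ((2 * l + 1) * d) * (3 ^ l * d ^ r) * n ^ (k + 1)) +
          (c₃ * (p * d ^ r)) * n ^ (k + 1) + d * (c₄ * (p * d ^ r * n ^ k))) := by gcongr
      _ = _ := by rw [hc₁]; ring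
  have hd0 : (0 : ℝ) < d := by exact_mod_cast hd
  have hz : (d : ℝ) ^ r = d * (d : ℝ) ^ ((r : ℤ) - 1) := by
    rw [zpow_sub_one₀ hd0.ne', zpow_natCast]
    field_simp
  have upper' : (d : ℝ) * N ≤ d * (p * n ^ (k + 1) * G) + c₂ * (p * n ^ (k + 1) * d ^ r) := by
    exact_mod_cast upper
  have lower' : (d : ℝ) * (p * n ^ (k + 1) * G) ≤ d * N +
      (d * (c₁ * (n ^ (k + 1) * d ^ (r + 1))) +
      c₃ * (p * n ^ (k + 1) * d ^ r) + d * (c₄ * (p * d ^ r * n ^ k))) := by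
    exact_mod_cast lower
  have hG : ∏ k ∈ kVerts T,
      (restrictedCompositions (T.deg (Sum.inr k) * d) (T.deg (Sum.inr k)) (2 * d) : ℝ) = (G : ℝ) := by
    push_cast [G]; rfl
  rw [hG, hlr, Nat.add_sub_cancel]
  set t₁ : ℝ := (n : ℝ) ^ (k + 1) * (d : ℝ) ^ (r + 1) with ht₁
  set t₂ : ℝ := (p : ℝ) * (n : ℝ) ^ (k + 1) * (d : ℝ) ^ ((r : ℤ) - 1) with ht₂
  set t₃ : ℝ := (p : ℝ) * (d : ℝ) ^ r * (n : ℝ) ^ k with ht₃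
  have ht₂' : (p : ℝ) * n ^ (k + 1) * d ^ r = d * t₂ := by rw [hz, ht₂]; ring
  rw [ht₂'] at upper' lower'
  have h₁ : 0 ≤ t₁ := by positivity
  have h₂ : 0 ≤ t₂ := by positivity
  have h₃ : 0 ≤ t₃ := by positivity
  have up : (N : ℝ) ≤ p * n ^ (k + 1) * G + c₂ * t₂ :=
    le_of_mul_le_mul_left (by linarith) hd0
  have low : (p : ℝ) * n ^ (k + 1) * G ≤ N + (c₁ * t₁ + c₃ * t₂ + c₄ * t₃) :=
    le_of_mul_le_mul_left (by linarith) hd0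
  have expand : ((c₁ + c₂ + c₃ + c₄ : ℕ) : ℝ) * (t₁ + t₂ + t₃) =
      c₂ * t₂ + (c₁ * t₁ + c₃ * t₂ + c₄ * t₃) +
      ((c₂ + c₃ + c₄) * t₁ + (c₁ + c₄) * t₂ + (c₁ + c₂ + c₃) * t₃) := by push_cast; ring
  have e₁ : 0 ≤ (c₂ : ℝ) * t₂ := by positivity
  have e₂ : 0 ≤ (c₁ : ℝ) * t₁ + c₃ * t₂ + c₄ * t₃ := by positivity
  have e₃ : 0 ≤ ((c₂ : ℝ) + c₃ + c₄) * t₁ + (c₁ + c₄) * t₂ + (c₁ + c₂ + c₃) * t₃ := by positivity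
  rw [expand, abs_le]
  constructor <;> linarith
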